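/- Let $X$ be a complex Banach space and let $A$ be the infinitesimal generator of a $C_0$-semigroup $T$ on $X$ such that $$\sigma(A)\cap i\mathbb R=\emptyset ,\qquad \sup_{\lambda\in i\mathbb R}\|(A-\lambda I)^{-1}\|<\infty .$$ Let $\mathcal F=C_b(\mathbb R,X)$ be the space of bounded continuous functions with the sup-norm. For $a\in\mathbb R$ let $\phi_a\in L^1(\mathbb R)$ be the function with Fourier transform $\int\phi_a(t)e^{-it\lambda}\,dt=\max(1-|\lambda-a|,0)$, and put $$\mathcal F_{as}=\Big\{x\in\mathcal F:\ \int_{\mathbb R}\|\phi_a*x\|_\infty\,da<\infty\Big\},\qquad \|x\|_{as}=5\sum_{m\in\mathbb Z}\|\phi_m*x\|_\infty .$$ Let $\mathscr L=-\frac{d}{dt}+A$ be the operator in $\mathcal F_{as}$ defined as follows: for $x,y\in\mathcal F_{as}$, $x\in D(\mathscr L)$ and $\mathscr Lx=y$ mean that $x(t)=T(t-s)x(s)-\int_s^tT(t-\tau)y(\tau)\,d\tau$ for all $s\le t$. Let $F(v)=F_1(v)+F_2(v,v)+\dots+F_n(v,\dots,v)$, $v\in X$, where each $F_k:X^k\to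 X$ is a bounded $k$-linear map, and write $F(x)$ also for the function $t\mapsto F(x(t))$. Then $\mathscr L$ is a bijection of $D(\mathscr L)$ onto $\mathcal F_{as}$ and $F$ maps $\mathcal F_{as}$ into itself, so that $\Phi=\mathscr L^{-1}\circ F:\mathcal F_{as}\to\mathcal F_{as}$ is well defined. For $y\in\mathcal F_{as}$ put $z=\mathscr L^{-1}y$. A mild solution of the non-linear equation $\mathscr Lx=y+F(x)$ is an $x\in\mathcal F_{as}$ with $x=z+\Phi(x)$. (This is the mild form of $Ax-x'=y+F(x)$, and it turns into $x'=Ax+y+F(x)$ when $(y,F)$ is replaced by $(-y,-F)$.) Let $\beta>0$ and $y\in\mathcal F_{as}$, let $L=L_{F,A}(\beta)\ge 0$ be a Lipschitz constant of $\Phi$ on the ball of radius $\beta$ centered at $z$, that is, $$\|\Phi(u)-\Phi(v)\|_{as}\le L\,\|u-v\|_{as}\quad\text{for all }u,v\in\mathcal F_{as}\text{ with }\|u-z\|_{as}<\beta,\ \|v-z\|_{as}<\beta ,$$ and suppose that $L<1$ and $\|\Phi(z)\|_{as}<\beta(1-L)$. Then there is a unique mild solution $x\in\mathcal F_{as}$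 satisfying $\|x-z\|_{as}\le\beta$. -/

import Mathlib

open Filter Topology MeasureTheory
open scoped NNReal ENNReal BoundedContinuousFunction

namespace ParabolicAS

variable {X : Type*} [NormedAddCommGroup X] [NormedSpace ℂ X]

/-! ### Semigroups, generators, resolvents -/

/-- `T` is a `C₀`-semigroup of bounded operators on `X`. -/
structure IsC0Semigroup (T : ℝ≥0 → X →L[ℂ] X) : Prop where
  map_zero : T 0 = ContinuousLinearMap.id ℂ X
  map_add : ∀ s t : ℝ≥0, T (s + t) = (T s).comp (T t)
  strongly_continuous : ∀ v : X, Continuous fun t : ℝ≥0 => T t v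

/-- `lim_{h → 0+} (T(h)v - v) / h = w`. -/
def HasGenerator (T : ℝ≥0 → X →L[ℂ] X) (v w : X) : Prop :=
  Tendsto (fun h : ℝ≥0 => (((h : ℝ) : ℂ)⁻¹) • (T h v - v)) (𝓝[>] 0) (𝓝 w)

theorem HasGenerator.add {T : ℝ≥0 → X →L[ℂ] X} {v w v' w' : X}
    (h : HasGenerator T v w) (h' : HasGenerator T v' w') :
    HasGenerator T (v + v') (w + w') := by
  unfold HasGenerator at *
  refine (Tendsto.add h h').congr fun s => ?_
  rw [← smul_add, map_add]
  congr 1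
  abel

theorem HasGenerator.smul {T : ℝ≥0 → X →L[ℂ] X} {v w : X} (c : ℂ)
    (h : HasGenerator T v w) : HasGenerator T (c • v) (c • w) := by
  unfold HasGenerator at *
  refine (Tendsto.const_smul h c).congr fun s => ?_
  rw [map_smul, ← smul_sub, smul_comm]

theorem HasGenerator.unique {T : ℝ≥0 → X →L[ℂ] X} {v w w' : X}
    (h : HasGenerator T v w) (h' : HasGenerator T v w') : w = w' :=
  tendsto_nhds_unique h h'

/-- The infinitesimal generator of `T`, an unbounded operator on `X`. -/
noncomputable def generator (T : ℝ≥0 → X →L[ℂ] X) : X →ₗ.[ℂ] X where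
  domain :=
    { carrier := {v | ∃ w, HasGenerator T v w}
      add_mem' := fun ⟨_, h⟩ ⟨_, h'⟩ => ⟨_, h.add h'⟩
      zero_mem' := ⟨0, by simp [HasGenerator]⟩
      smul_mem' := fun c _ ⟨_, h⟩ => ⟨_, h.smul c⟩ }
  toFun :=
    { toFun := fun v => Classical.choose v.2
      map_add' := fun v v' => HasGenerator.unique (Classical.choose_spec (v + v').2)
        ((Classical.choose_spec v.2).add (Classical.choose_spec v'.2))
      map_smul' := fun c v => HasGenerator.unique (Classical.choose_spec (c • v).2)
        ((Classical.choose_spec v.2).smul c) }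

/-- The bounded operator `R` is the inverse `(A - μ I)⁻¹` of `A - μ I : D(A) → X`. -/
def IsResolventAt (A : X →ₗ.[ℂ] X) (μ : ℂ) (R : X →L[ℂ] X) : Prop :=
  (∀ v : X, ∃ h : R v ∈ A.domain, A ⟨R v, h⟩ - μ • R v = v) ∧
    ∀ v : A.domain, R (A v - μ • (v : X)) = v

/-- The spectrum of an unbounded operator. -/
def opSpectrum (A : X →ₗ.[ℂ] X) : Set ℂ := {μ | ¬ ∃ R : X →L[ℂ] X, IsResolventAt A μ R}

/-- The imaginary axis. -/
def imagAxis : Set ℂ := {μ | μ.re = 0}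

/-- `sup_{μ ∈ iℝ} ‖(A - μ I)⁻¹‖ < ∞`. -/
def ResolventBddOnImagAxis (A : X →ₗ.[ℂ] X) : Prop :=
  ∃ M : ℝ, ∀ μ ∈ imagAxis, ∀ R : X →L[ℂ] X, IsResolventAt A μ R → ‖R‖ ≤ M

/-! ### Functions with absolutely summable spectrum -/

/-- `(1 - |l|) χ_{[-1,1]}(l)`. -/
noncomputable def triangle (l : ℝ) : ℝ := Set.indicator (Set.Icc (-1) 1) (fun l => 1 - |l|) l

/-- The function `φ_a ∈ L¹(ℝ)` whose Fourier transform (`∫ f(t) e^{-itl} dt`) is the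
translated triangle `l ↦ triangle (l - a)`, given by Fourier inversion. -/
noncomputable def phi (a t : ℝ) : ℂ :=
  (1 / (2 * Real.pi) : ℂ) *
    ∫ l : ℝ, (triangle (l - a) : ℂ) * Complex.exp (Complex.I * (l : ℂ) * (t : ℂ))

/-- The convolution `φ_a * x`. -/
noncomputable def phiConv (a : ℝ) (x : ℝ →ᵇ X) (t : ℝ) : X := ∫ s : ℝ, phi a s • x (t - s)

/-- The supremum norm of `φ_a * x`, in `[0, ∞]`. -/
noncomputable def phiConvNorm (a : ℝ) (x : ℝ →ᵇ X) : ℝ≥0∞ := ⨆ t : ℝ, ‖phiConv a x t‖ₑ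

/-- Membership in the subspace `F_as` of `F = C_b(ℝ, X)`: `∫ ‖φ_a * x‖_∞ da < ∞`. -/
def MemAS (x : ℝ →ᵇ X) : Prop := ∫⁻ a : ℝ, phiConvNorm a x < ∞

/-- The norm `‖x‖_as = 5 ∑_{n ∈ ℤ} ‖φ_n * x‖_∞` of `F_as`, with values in `[0, ∞]`. -/
noncomputable def asNorm (x : ℝ →ᵇ X) : ℝ≥0∞ := 5 * ∑' n : ℤ, phiConvNorm (n : ℝ) x

/-- The open ball of `F_as` with centre `c` and radius `r`. -/
def asBall (c : ℝ →ᵇ X) (r : ℝ) : Set (ℝ →ᵇ X) :=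
  {x | MemAS x ∧ asNorm (x - c) < ENNReal.ofReal r}

/-! ### The differential operator `-d/dt + A` -/

/-- `x` is in the domain of the operator `L = -d/dt + A` of `F_as`, and `L x = y`. -/
def IsL (T : ℝ≥0 → X →L[ℂ] X) (x y : ℝ →ᵇ X) : Prop :=
  MemAS x ∧ MemAS y ∧ ∀ s t : ℝ, s ≤ t →
    x t = T (t - s).toNNReal (x s) - ∫ τ in s..t, T (t - τ).toNNReal (y τ)

open Classical in
/-- The inverse of the operator `L` of `F_as` (with value `0` off the range of `L`). -/
noncomputable def LInv (T : ℝ≥0 → X →L[ℂ] X) (y : ℝ →ᵇ X) : ℝ →ᵇ X :=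
  if h : ∃ x, IsL T x y then Classical.choose h else 0

/-! ### The non-linear term -/

/-- `F(v) = F₁(v) + F₂(v, v) + ⋯ + Fₙ(v, …, v)`. -/
def poly (n : ℕ) (F : (k : ℕ) → ContinuousMultilinearMap ℂ (fun _ : Fin k => X) X) (v : X) : X :=
  ∑ k ∈ Finset.Icc 1 n, F k fun _ => v

theorem continuous_poly (n : ℕ)
    (F : (k : ℕ) → ContinuousMultilinearMap ℂ (fun _ : Fin k => X) X) :
    Continuous (poly n F) := by
  unfold poly
  exact continuous_finsetSum _ fun k _ => (F k).cont.comp (continuous_pi fun _ => continuous_id)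

theorem norm_poly_le (n : ℕ)
    (F : (k : ℕ) → ContinuousMultilinearMap ℂ (fun _ : Fin k => X) X) {v : X} {r : ℝ}
    (hv : ‖v‖ ≤ r) : ‖poly n F v‖ ≤ ∑ k ∈ Finset.Icc 1 n, ‖F k‖ * r ^ k := by
  unfold poly
  refine (norm_sum_le _ _).trans (Finset.sum_le_sum fun k _ => ?_)
  refine ((F k).le_opNorm _).trans ?_
  rw [Finset.prod_const, Finset.card_univ, Fintype.card_fin]
  gcongr

/-- The map `x ↦ F(x(·))` on `C_b(ℝ, X)`. -/
noncomputable def polyComp (n : ℕ)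
    (F : (k : ℕ) → ContinuousMultilinearMap ℂ (fun _ : Fin k => X) X) (x : ℝ →ᵇ X) : ℝ →ᵇ X :=
  BoundedContinuousFunction.ofNormedAddCommGroup (fun t => poly n F (x t))
    ((continuous_poly n F).comp x.continuous) (∑ k ∈ Finset.Icc 1 n, ‖F k‖ * ‖x‖ ^ k)
    (fun t => norm_poly_le n F (x.norm_coe_le_norm t))

/-- The non-linear map `Φ = L⁻¹ ∘ F`. -/
noncomputable def Phi (T : ℝ≥0 → X →L[ℂ] X) (n : ℕ)
    (F : (k : ℕ) → ContinuousMultilinearMap ℂ (fun _ : Fin k => X) X) (x : ℝ →ᵇ X) : ℝ →ᵇ X :=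
  LInv T (polyComp n F x)

/-- `K` is a Lipschitz constant, in the norm of `F_as`, of `Φ` on the set `B`. -/
def AsLipschitzOn (K : ℝ≥0) (Φ : (ℝ →ᵇ X) → ℝ →ᵇ X) (B : Set (ℝ →ᵇ X)) : Prop :=
  ∀ u ∈ B, ∀ v ∈ B, asNorm (Φ u - Φ v) ≤ K * asNorm (u - v)

/-- `x ∈ F_as` is a mild solution of the non-linear equation: `x = z + Φ(x)` with `z = L⁻¹ y`. -/
def IsMildSolution (T : ℝ≥0 → X →L[ℂ] X) (n : ℕ)
    (F : (k : ℕ) → ContinuousMultilinearMap ℂ (fun _ : Fin k => X) X) (y x : ℝ →ᵇ X) : Prop :=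
  MemAS x ∧ x = LInv T y + Phi T n F x

end ParabolicAS

/-! Spectral localization: `phiC a` is the Fourier multiplier with symbol `triangle (l - a)`, and
unit-spaced triangles form a partition of unity. Hence `φ_a * x` is a sum of four pieces `φ_a * φ_b
* x` (`phiC_eq_sum`), so the integral in `MemAS` and the sum in `asNorm` are finite together. Every
`x` in `F_as` is the uniformly convergent sum of the `φ_n * x` (`hasSum_phiC`), so `asNorm`
dominates the sup-norm. On functions with spectrum in a band, the two norms are comparable with a
constant depending only on the width (`asNorm_le_of_band`).

Inverting the linear operator: by the resolvent identity, the resolvent `R l` at `il` is smooth in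
`l` with bounded derivatives. Its smooth cut-offs to windows of fixed width therefore have inverse
Fourier transforms bounded in `L¹` uniformly in the centre (`exists_kernel`). Convolving `φ_n * y`
with the kernel centred at `n` solves the equation for that piece, costs a fixed constant, and keeps
the spectrum in the band; so the solutions can be summed in `F_as`. For uniqueness, the difference
of two solutions is a bounded orbit `w` of the semigroup on the whole line. Its truncated Fourier
integrals are boundary terms, and after pairing with `φ_c` these tend to zero by Riemann–Lebesgue,
so `φ_c * w = 0` for every `c` (`eq_zero_of_orbit`).

The polynomial: the spectrum of a product lies in the sum of the spectra
(`integral_smul_mlComp_eq_zero`). Expanding a `k`-linear term over the pieces `φ_n * x` thus gives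
band-limited functions, and their norms add up to a multiple of the `k`-th power of the sum of the
`‖φ_n * x‖`.

The nonlinear equation: Picard iteration from `z` stays in the ball where `Φ` contracts. The
Lipschitz estimate is available only on the open ball while uniqueness is claimed in the closed one.
For a solution `x` in the closed ball the estimate is carried to `x` along the segment from `z`,
because `Φ` is closed under uniform convergence (`Phi_eq_of_tendsto`). Then `‖x - z‖ = ‖Φ(x)‖ ≤
‖Φ(z)‖ + Lβ < β`, and the contraction applies. -/

namespace ParabolicAS

open scoped FourierTransform

/-! ### Inverse Fourier transforms of vector-valued symbols -/

section Synth

variable {E : Type*} [NormedAddCommGroup E] [NormedSpace ℂ E]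

/-- The inverse Fourier transform `t ↦ (2π)⁻¹ ∫ e^{ilt} f(l) dl`. -/
noncomputable def synth (f : ℝ → E) (t : ℝ) : E :=
  (1 / (2 * Real.pi) : ℂ) • ∫ l : ℝ, Complex.exp (Complex.I * (l : ℂ) * (t : ℂ)) • f l

/-- The Fourier transform `l ↦ ∫ e^{-ils} h(s) ds`. -/
noncomputable def ft (h : ℝ → ℂ) (l : ℝ) : ℂ :=
  ∫ s : ℝ, h s * Complex.exp (-(Complex.I * (l : ℂ) * (s : ℂ)))

theorem norm_exp_I_mul (l t : ℝ) : ‖Complex.exp (Complex.I * (l : ℂ) * (t : ℂ))‖ = 1 := by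
  rw [show Complex.I * (l : ℂ) * (t : ℂ) = ((l * t : ℝ) : ℂ) * Complex.I by push_cast; ring]
  exact Complex.norm_exp_ofReal_mul_I _

theorem norm_exp_neg_I_mul (l t : ℝ) : ‖Complex.exp (-(Complex.I * (l : ℂ) * (t : ℂ)))‖ = 1 := by
  rw [Complex.exp_neg, norm_inv, norm_exp_I_mul, inv_one]

theorem integrable_exp_smul {f : ℝ → E} (hf : Integrable f) (t : ℝ) :
    Integrable fun l : ℝ => Complex.exp (Complex.I * (l : ℂ) * (t : ℂ)) • f l := by
  refine hf.bdd_smul 1 ?_ (ae_of_all _ fun l => (norm_exp_I_mul l t).le)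
  exact Continuous.aestronglyMeasurable (by fun_prop)

theorem synth_eq_fourierInv (f : ℝ → E) (t : ℝ) :
    synth f t = (1 / (2 * Real.pi) : ℂ) • 𝓕⁻ f (t / (2 * Real.pi)) := by
  rw [synth, Real.fourierInv_eq']
  congr 2
  ext l
  congr 2
  have : (Real.pi : ℂ) ≠ 0 := by exact_mod_cast Real.pi_ne_zero
  simp
  field_simp

theorem synth_eq_fourier (f : ℝ → E) (t : ℝ) :
    synth f t = (1 / (2 * Real.pi) : ℂ) • 𝓕 f (-(t / (2 * Real.pi))) := by
  rw [synth_eq_fourierInv, Real.fourierInv_eq_fourier_neg]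

theorem continuous_synth {f : ℝ → E} (hf : Integrable f) : Continuous (synth f) := by
  unfold synth
  refine Continuous.const_smul ?_ _
  refine continuous_of_dominated 
    (F := fun (t l : ℝ) => Complex.exp (Complex.I * (l : ℂ) * (t : ℂ)) • f l)
    (bound := fun l => ‖f l‖) (fun t => (integrable_exp_smul hf t).1) (fun t => ae_of_all _ fun l => ?_)
    hf.norm (ae_of_all _ fun l => by fun_prop)
  rw [norm_smul, norm_exp_I_mul, one_mul]

theorem norm_two_pi_inv : ‖(1 / (2 * Real.pi) : ℂ)‖ = 1 / (2 * Real.pi) := by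
  have : (1 / (2 * Real.pi) : ℂ) = ((1 / (2 * Real.pi) : ℝ) : ℂ) := by push_cast; rfl
  rw [this, Complex.norm_real, Real.norm_of_nonneg (by positivity)]

theorem norm_two_pi_inv_le : ‖(1 / (2 * Real.pi) : ℂ)‖ ≤ 1 := by
  rw [norm_two_pi_inv, div_le_one (by positivity)]
  linarith [Real.pi_gt_three]

theorem norm_synth_le (f : ℝ → E) (t : ℝ) : ‖synth f t‖ ≤ ∫ l, ‖f l‖ := by
  rw [synth, norm_smul]
  refine (mul_le_of_le_one_left (norm_nonneg _) norm_two_pi_inv_le).trans ?_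
  refine (norm_integral_le_integral_norm _).trans_eq ?_
  simp [norm_smul, norm_exp_I_mul]

/-- Riemann–Lebesgue, used on operator-valued symbols to kill the boundary terms of bounded orbits.
-/
theorem tendsto_synth_cocompact (f : ℝ → E) : Tendsto (synth f) (cocompact ℝ) (𝓝 0) := by
  have h : Tendsto (fun t : ℝ => -(t / (2 * Real.pi))) (cocompact ℝ) (cocompact ℝ) := by
    have := (Homeomorph.mulRight₀ (-(2 * Real.pi)⁻¹ : ℝ) (by
      simp [Real.pi_ne_zero])).isClosedEmbedding.tendsto_cocompact
    refine this.congr fun t => ?_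
    simp [div_eq_mul_inv]
  have := ((Real.zero_at_infty_fourier f).comp h).const_smul (1 / (2 * Real.pi) : ℂ)
  rw [smul_zero] at this
  exact this.congr fun t => (synth_eq_fourier f t).symm

theorem synth_shift (f : ℝ → E) (a t : ℝ) :
    synth (fun l => f (l - a)) t = Complex.exp (Complex.I * (a : ℂ) * (t : ℂ)) • synth f t := by
  rw [synth, synth, smul_comm (Complex.exp _), ← integral_smul (Complex.exp _)]
  rw [← integral_add_right_eq_self
    (fun l : ℝ => Complex.exp (Complex.I * (l : ℂ) * (t : ℂ)) • f (l - a)) a]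
  refine congrArg _ (integral_congr_ae (ae_of_all _ fun l => ?_))
  simp only
  rw [add_sub_cancel_right, smul_smul, ← Complex.exp_add]
  congr 2
  push_cast
  ring

/-- Convolution with `h` multiplies the symbol by the Fourier transform of `h`. -/
theorem conv_synth [CompleteSpace E] {h : ℝ → ℂ} {f : ℝ → E} (hh : Integrable h) (hf : Integrable f)
    (t : ℝ) : ∫ s, h s • synth f (t - s) = synth (fun l => ft h l • f l) t := by
  -- The exponential is unimodular, so Fubini needs only the product integrability of `h` and `f`.
  have key : Integrable (Function.uncurry fun s l : ℝ =>
      h s • Complex.exp (Complex.I * (l : ℂ) * ((t - s : ℝ) : ℂ)) • f l) (volume.prod volume) := by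
    have h1 : Integrable (fun p : ℝ × ℝ => h p.1 • f p.2) (volume.prod volume) := hh.smul_prod hf
    refine (h1.bdd_smul (φ := fun p : ℝ × ℝ => Complex.exp (Complex.I * (p.2 : ℂ) * ((t - p.1 : ℝ) : ℂ)))
      1 (Continuous.aestronglyMeasurable (by fun_prop)) (ae_of_all _ fun p =>
      (norm_exp_I_mul _ _).le)).congr (ae_of_all _ fun p => ?_)
    simp only [Pi.smul_apply', Function.uncurry]
    rw [smul_comm]
  calc ∫ s, h s • synth f (t - s)
      = (1 / (2 * Real.pi) : ℂ) • ∫ s : ℝ, ∫ l : ℝ, h s •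
          Complex.exp (Complex.I * (l : ℂ) * ((t - s : ℝ) : ℂ)) • f l := by
        rw [← integral_smul]
        congr 1
        ext s
        rw [synth, smul_comm, integral_smul]
    _ = (1 / (2 * Real.pi) : ℂ) • ∫ l : ℝ, ∫ s : ℝ, h s •
          Complex.exp (Complex.I * (l : ℂ) * ((t - s : ℝ) : ℂ)) • f l := by
        rw [integral_integral_swap key]
    _ = _ := by
        rw [synth]
        refine congrArg _ (integral_congr_ae (ae_of_all _ fun l => ?_))
        simp only
        rw [ft, ← integral_smul_const, ← integral_smul]
        congr 1
        ext s
        rw [smul_smul, smul_smul]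
        congr 1
        rw [mul_left_comm, ← Complex.exp_add]
        congr 2
        push_cast
        ring

end Synth

/-! ### The triangle function and the Fejér kernels `φ_a` -/

theorem triangle_eq (l : ℝ) : triangle l = max (1 - |l|) 0 := by
  unfold triangle Set.indicator
  split_ifs with h
  · rw [max_eq_left]
    have := abs_le.2 ⟨h.1, h.2⟩
    linarith
  · rw [max_eq_right]
    by_contra! hc
    exact h ⟨(abs_le.1 (by linarith : |l| ≤ 1)).1, (abs_le.1 (by linarith : |l| ≤ 1)).2⟩

theorem continuous_triangle : Continuous triangle := by
  simp_rw [funext triangle_eq]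
  fun_prop

theorem triangle_nonneg (l : ℝ) : 0 ≤ triangle l := by
  rw [triangle_eq]; exact le_max_right _ _

theorem triangle_eq_zero {l : ℝ} (h : 1 ≤ |l|) : triangle l = 0 := by
  rw [triangle_eq, max_eq_right]; linarith

theorem triangle_of_le {l : ℝ} (h : |l| ≤ 1) : triangle l = 1 - |l| := by
  rw [triangle_eq, max_eq_left]; linarith

theorem hasCompactSupport_triangle : HasCompactSupport triangle :=
  HasCompactSupport.of_support_subset_isCompact (isCompact_Icc (a := (-1 : ℝ)) (b := 1))
    (Set.support_indicator_subset)

/-- The triangle as a complex-valued symbol. -/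
noncomputable def ctri (l : ℝ) : ℂ := (triangle l : ℂ)

theorem continuous_ctri : Continuous ctri := Complex.continuous_ofReal.comp continuous_triangle

theorem integrable_ctri : Integrable ctri :=
  (continuous_triangle.integrable_of_hasCompactSupport hasCompactSupport_triangle).ofReal

theorem ctri_eq_zero {l : ℝ} (h : 1 ≤ |l|) : ctri l = 0 := by
  rw [ctri, triangle_eq_zero h, Complex.ofReal_zero]

theorem integrable_ctri_sub (a : ℝ) : Integrable fun l => ctri (l - a) :=
  integrable_ctri.comp_sub_right a

theorem phi_eq_synth (a t : ℝ) : phi a t = synth (fun l => ctri (l - a)) t := by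
  simp only [phi, synth, smul_eq_mul, ctri, mul_comm]

theorem phi_eq_exp_mul (a t : ℝ) :
    phi a t = Complex.exp (Complex.I * (a : ℂ) * (t : ℂ)) * phi 0 t := by
  rw [phi_eq_synth, phi_eq_synth, synth_shift]
  simp

theorem norm_phi (a t : ℝ) : ‖phi a t‖ = ‖phi 0 t‖ := by
  rw [phi_eq_exp_mul, norm_mul, norm_exp_I_mul, one_mul]

theorem continuous_phi (a : ℝ) : Continuous (phi a) := by
  simp_rw [funext (phi_eq_synth a)]
  exact continuous_synth (integrable_ctri_sub a)

/-- The Fejér formula for the kernel `φ_0`. -/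
theorem phi_zero_eq {t : ℝ} (ht : t ≠ 0) :
    phi 0 t = (1 / (2 * Real.pi) : ℂ) * ((2 * (1 - Real.cos t) / t ^ 2 : ℝ) : ℂ) := by
  have hc : (t : ℂ) ≠ 0 := by exact_mod_cast ht
  set e : ℝ → ℂ := fun l => Complex.exp (Complex.I * (l : ℂ) * (t : ℂ)) with he
  have hde : ∀ l : ℝ, HasDerivAt e (e l * (Complex.I * t)) l := by
    intro l
    have h0 : HasDerivAt (fun l : ℝ => Complex.I * (l : ℂ) * (t : ℂ)) (Complex.I * 1 * t) l :=
      ((Complex.ofRealCLM.hasDerivAt (x := l)).const_mul Complex.I).mul_const (t : ℂ)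
    simpa using h0.cexp
  have hce : Continuous e := by fun_prop
  have hI : Complex.I * (t : ℂ) ≠ 0 := mul_ne_zero Complex.I_ne_zero hc
  have hsq : (Complex.I * (t : ℂ)) ^ 2 = -(t : ℂ) ^ 2 := by rw [mul_pow, Complex.I_sq]; ring
  have h1 : ∫ l in (0 : ℝ)..1, (1 - (l : ℂ)) * e l
      = e 1 / (Complex.I * t) ^ 2 - (1 / (Complex.I * t) + 1 / (Complex.I * t) ^ 2) := by
    rw [intervalIntegral.integral_eq_sub_of_hasDerivAt (f := fun l : ℝ =>
      (1 - (l : ℂ)) * e l / (Complex.I * t) + e l / (Complex.I * t) ^ 2)]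
    · simp [he]
    · intro l _
      have hl : HasDerivAt (fun l : ℝ => 1 - (l : ℂ)) (-1) l := by
        simpa using (Complex.ofRealCLM.hasDerivAt (x := l)).const_sub 1
      refine (((hl.mul (hde l)).div_const (Complex.I * t)).add
        ((hde l).div_const ((Complex.I * t) ^ 2))).congr_deriv ?_
      field_simp
      ring
    · exact Continuous.intervalIntegrable (by fun_prop) _ _
  have h2 : ∫ l in (-1 : ℝ)..0, (1 + (l : ℂ)) * e l
      = (1 / (Complex.I * t) - 1 / (Complex.I * t) ^ 2) + e (-1) / (Complex.I * t) ^ 2 := by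
    rw [intervalIntegral.integral_eq_sub_of_hasDerivAt (f := fun l : ℝ =>
      (1 + (l : ℂ)) * e l / (Complex.I * t) - e l / (Complex.I * t) ^ 2)]
    · simp [he]
    · intro l _
      have hl : HasDerivAt (fun l : ℝ => 1 + (l : ℂ)) 1 l := by
        simpa using (Complex.ofRealCLM.hasDerivAt (x := l)).const_add 1
      refine (((hl.mul (hde l)).div_const (Complex.I * t)).sub
        ((hde l).div_const ((Complex.I * t) ^ 2))).congr_deriv ?_
      field_simp
      ring
    · exact Continuous.intervalIntegrable (by fun_prop) _ _
  have hsplit : ∫ l : ℝ, (triangle (l - 0) : ℂ) * e l = ∫ l in (-1 : ℝ)..1, ctri l * e l := by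
    rw [intervalIntegral.integral_of_le (by norm_num), ← integral_Icc_eq_integral_Ioc,
      setIntegral_eq_integral_of_forall_compl_eq_zero]
    · simp [ctri]
    · intro l hl
      rw [ctri_eq_zero, zero_mul]
      by_contra! hlt
      exact hl ⟨(abs_lt.1 hlt).1.le, (abs_lt.1 hlt).2.le⟩
  have hint : ∀ a b : ℝ, IntervalIntegrable (fun l => ctri l * e l) volume a b := fun a b =>
    Continuous.intervalIntegrable (continuous_ctri.mul hce) _ _
  have e1 : ∫ l in (-1 : ℝ)..0, ctri l * e l = ∫ l in (-1 : ℝ)..0, (1 + (l : ℂ)) * e l := by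
    refine intervalIntegral.integral_congr fun l hl => ?_
    rw [Set.uIcc_of_le (by norm_num)] at hl
    have : |l| = -l := abs_of_nonpos hl.2
    simp only [ctri]
    rw [triangle_of_le (by rw [this]; linarith [hl.1]), this]
    push_cast
    ring
  have e2 : ∫ l in (0 : ℝ)..1, ctri l * e l = ∫ l in (0 : ℝ)..1, (1 - (l : ℂ)) * e l := by
    refine intervalIntegral.integral_congr fun l hl => ?_
    rw [Set.uIcc_of_le (by norm_num)] at hl
    have : |l| = l := abs_of_nonneg hl.1
    simp only [ctri]
    rw [triangle_of_le (by rw [this]; linarith [hl.2]), this]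
    push_cast
    ring
  rw [phi, hsplit, ← intervalIntegral.integral_add_adjacent_intervals (hint (-1) 0) (hint 0 1),
    e1, e2, h1, h2]
  congr 1
  have hcos : e 1 + e (-1) = 2 * (Real.cos t : ℂ) := by
    rw [Complex.ofReal_cos, Complex.two_cos]
    simp only [he]
    push_cast
    congr 2 <;> ring
  have : e 1 = 2 * (Real.cos t : ℂ) - e (-1) := by rw [← hcos]; ring
  rw [this, hsq]
  push_cast
  field_simp
  ring

/-- The triangle has integral at most `2` (a crude bound), and the Fejér formula gives `t ^ 2 * ‖phi
a t‖ ≤ 4`, since `1 - cos t ≤ 2`; adding the two yields the constant `6`. The decay makes `φ_a`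
integrable. -/
theorem norm_phi_le (a t : ℝ) : ‖phi a t‖ ≤ 6 * (1 + t ^ 2)⁻¹ := by
  have hI : ∫ l, ‖ctri (l - 0)‖ ≤ 2 := by
    simp only [sub_zero]
    calc ∫ l, ‖ctri l‖ = ∫ l in Set.Icc (-1 : ℝ) 1, ‖ctri l‖ := by
          rw [setIntegral_eq_integral_of_forall_compl_eq_zero]
          intro l hl
          rw [ctri_eq_zero, norm_zero]
          by_contra! hlt
          exact hl ⟨(abs_lt.1 hlt).1.le, (abs_lt.1 hlt).2.le⟩
      _ ≤ ∫ l in Set.Icc (-1 : ℝ) 1, (1 : ℝ) := by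
          refine setIntegral_mono integrable_ctri.norm.integrableOn (by simp) fun l => ?_
          rw [ctri, Complex.norm_real, Real.norm_of_nonneg (triangle_nonneg _), triangle_eq]
          exact max_le (by linarith [abs_nonneg l]) zero_le_one
      _ = 2 := by simp; norm_num
  have h0 : ‖phi a t‖ ≤ 2 := by
    rw [norm_phi, phi_eq_synth]
    exact (norm_synth_le _ _).trans hI
  have h1 : t ^ 2 * ‖phi a t‖ ≤ 4 := by
    rcases eq_or_ne t 0 with rfl | ht
    · simp
    · rw [norm_phi, phi_zero_eq ht, norm_mul, Complex.norm_real, Real.norm_of_nonneg (by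
        have := Real.cos_le_one t
        positivity [show 0 ≤ 1 - Real.cos t by linarith])]
      have hc := Real.cos_le_one t
      have hc' := Real.neg_one_le_cos t
      have : t ^ 2 * (‖(1 / (2 * Real.pi) : ℂ)‖ * (2 * (1 - Real.cos t) / t ^ 2))
        = ‖(1 / (2 * Real.pi) : ℂ)‖ * (2 * (1 - Real.cos t)) := by field_simp
      rw [this]
      refine (mul_le_of_le_one_left (by linarith) norm_two_pi_inv_le).trans (by linarith)
  rw [← div_eq_mul_inv, le_div_iff₀ (by positivity)]
  nlinarith

theorem integrable_phi (a : ℝ) : Integrable (phi a) := by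
  refine (integrable_inv_one_add_sq.const_mul 6).mono' (continuous_phi a).aestronglyMeasurable
    (ae_of_all _ fun t => norm_phi_le a t)

/-- The common `L¹`-norm of the kernels `φ_a`. -/
noncomputable def phiL1 : ℝ := ∫ t, ‖phi 0 t‖

theorem integral_norm_phi (a : ℝ) : ∫ t, ‖phi a t‖ = phiL1 := by
  simp only [norm_phi a, phiL1]

/-- One point where the kernel does not vanish is enough to recover `x` from `φ_0(s) x(t + 1 - s)`.
-/
theorem phi_zero_one_ne_zero : phi 0 1 ≠ 0 := by
  rw [phi_zero_eq one_ne_zero]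
  refine mul_ne_zero ?_ ?_
  · rw [← norm_ne_zero_iff, norm_two_pi_inv]
    positivity
  · have : Real.cos 1 < 1 := by
      have := Real.cos_one_le
      linarith
    exact_mod_cast (by norm_num; linarith : (2 * (1 - Real.cos 1) / 1 ^ 2 : ℝ) ≠ 0)

/-- Fourier inversion for the triangle, legitimate because its transform `φ_a` is integrable. The
factors `2π` convert between the normalization of `𝓕` and that of `ft`. -/
theorem ft_phi (a l : ℝ) : ft (phi a) l = ctri (l - a) := by
  set f : ℝ → ℂ := fun l => ctri (l - a)
  have hpi : (Real.pi : ℂ) ≠ 0 := by exact_mod_cast Real.pi_ne_zero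
  have hfour : ∀ v, 𝓕 f v = (2 * Real.pi : ℂ) * phi a (-(2 * Real.pi * v)) := by
    intro v
    rw [phi_eq_synth, synth_eq_fourier, smul_eq_mul, ← mul_assoc,
      show -(-(2 * Real.pi * v) / (2 * Real.pi)) = v by field_simp]
    field_simp
    rfl
  have hinv : ∀ v, 𝓕⁻ f v = (2 * Real.pi : ℂ) * phi a (2 * Real.pi * v) := by
    intro v
    rw [Real.fourierInv_eq_fourier_neg, hfour]
    ring_nf
  have hint : Integrable (𝓕 f) := by
    rw [funext hfour]
    refine Integrable.const_mul ?_ _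
    have := (integrable_phi a).comp_mul_left' (R := -(2 * Real.pi)) (by simp [Real.pi_ne_zero])
    simpa using this
  have key := congrFun (Continuous.fourier_fourierInv_eq (f := f)
    (continuous_ctri.comp (by fun_prop)) (integrable_ctri_sub a) hint) l
  rw [Real.fourier_eq'] at key
  simp only [hinv] at key
  change _ = f l
  rw [← key, ft]
  have := Measure.integral_comp_mul_left (fun s : ℝ =>
    phi a s * Complex.exp (-(Complex.I * (l : ℂ) * (s : ℂ)))) (2 * Real.pi)
  rw [abs_of_pos (by positivity)] at this
  rw [eq_comm, inv_smul_eq_iff₀ (by positivity)] at this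
  rw [this, ← integral_smul]
  congr 1
  ext s
  rw [Complex.real_smul, smul_eq_mul]
  push_cast
  have harg : Complex.exp (-2 * (Real.pi : ℂ) * ((inner ℝ s l : ℝ) : ℂ) * Complex.I)
      = Complex.exp (-(Complex.I * (l : ℂ) * (2 * (Real.pi : ℂ) * (s : ℂ)))) := by
    congr 1
    simp
    ring
  rw [harg]
  ring

/-- Four consecutive triangles sum to one on the middle of their common range. -/
theorem sum_ctri_eq_one {b l : ℝ} (h1 : b - 2 ≤ l) (h2 : l ≤ b + 1) :
    ∑ j ∈ Finset.range 4, ctri (l - (b - 2 + j)) = 1 := by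
  have h : ∑ j ∈ Finset.range 4, triangle (l - (b - 2 + j)) = 1 := by
    simp only [Finset.sum_range_succ, Finset.sum_range_zero, triangle_eq]
    push_cast
    rcases le_total l (b - 1) with h3 | h3
    · rw [abs_of_nonneg (by linarith : 0 ≤ l - (b - 2 + 0)),
        abs_of_nonpos (by linarith : l - (b - 2 + 1) ≤ 0),
        abs_of_nonpos (by linarith : l - (b - 2 + 2) ≤ 0),
        abs_of_nonpos (by linarith : l - (b - 2 + 3) ≤ 0),
        max_eq_left (by linarith), max_eq_left (by linarith), max_eq_right (by linarith),
        max_eq_right (by linarith)]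
      ring
    rcases le_total l b with h4 | h4
    · rw [abs_of_nonneg (by linarith : 0 ≤ l - (b - 2 + 0)),
        abs_of_nonneg (by linarith : 0 ≤ l - (b - 2 + 1)),
        abs_of_nonpos (by linarith : l - (b - 2 + 2) ≤ 0),
        abs_of_nonpos (by linarith : l - (b - 2 + 3) ≤ 0),
        max_eq_right (by linarith), max_eq_left (by linarith), max_eq_left (by linarith),
        max_eq_right (by linarith)]
      ring
    · rw [abs_of_nonneg (by linarith : 0 ≤ l - (b - 2 + 0)),
        abs_of_nonneg (by linarith : 0 ≤ l - (b - 2 + 1)),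
        abs_of_nonneg (by linarith : 0 ≤ l - (b - 2 + 2)),
        abs_of_nonpos (by linarith : l - (b - 2 + 3) ≤ 0),
        max_eq_right (by linarith), max_eq_right (by linarith), max_eq_left (by linarith),
        max_eq_left (by linarith)]
      ring
  unfold ctri
  exact_mod_cast h

/-! ### Convolution operators and the multipliers `φ_a *` -/

section ConvOp

variable {X : Type*} [NormedAddCommGroup X] [NormedSpace ℂ X]

theorem norm_kernel_apply_le (K : ℝ → X →L[ℂ] X) (x : ℝ →ᵇ X) (s t : ℝ) :
    ‖K s (x t)‖ ≤ ‖K s‖ * ‖x‖ :=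
  (K s).le_opNorm_of_le (x.norm_coe_le_norm t)

theorem integrable_kernel_apply {K : ℝ → X →L[ℂ] X} (hK : Integrable K) (x : ℝ →ᵇ X) (t : ℝ) :
    Integrable fun s => K s (x (t - s)) := by
  refine (hK.norm.mul_const ‖x‖).mono' ?_ (ae_of_all _ fun s => norm_kernel_apply_le K x s _)
  exact (ContinuousLinearMap.id ℂ (X →L[ℂ] X)).aestronglyMeasurable_comp₂ hK.1
    (x.continuous.comp (continuous_const.sub continuous_id)).aestronglyMeasurable

theorem norm_integral_kernel_le {K : ℝ → X →L[ℂ] X} (hK : Integrable K) (x : ℝ →ᵇ X) (t : ℝ) :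
    ‖∫ s, K s (x (t - s))‖ ≤ (∫ s, ‖K s‖) * ‖x‖ := by
  rw [← integral_mul_const]
  exact norm_integral_le_of_norm_le (hK.norm.mul_const ‖x‖)
    (ae_of_all _ fun s => norm_kernel_apply_le K x s _)

/-- Convolution with an integrable operator-valued kernel, on `C_b(ℝ, X)`. -/
noncomputable def convOp (K : ℝ → X →L[ℂ] X) (hK : Integrable K) : (ℝ →ᵇ X) →L[ℂ] (ℝ →ᵇ X) :=
  LinearMap.mkContinuous
    { toFun := fun x => BoundedContinuousFunction.ofNormedAddCommGroup
        (fun t => ∫ s, K s (x (t - s)))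
        (by
          refine continuous_of_dominated (F := fun t s => K s (x (t - s)))
            (bound := fun s => ‖K s‖ * ‖x‖) (fun t => (integrable_kernel_apply hK x t).1)
            (fun t => ae_of_all _ fun s => norm_kernel_apply_le K x s _)
            (hK.norm.mul_const ‖x‖) (ae_of_all _ fun s => ?_)
          exact (K s).continuous.comp (x.continuous.comp (continuous_id.sub continuous_const)))
        ((∫ s, ‖K s‖) * ‖x‖)
        (norm_integral_kernel_le hK x)
      map_add' := fun x y => by
        ext t
        simp only [BoundedContinuousFunction.coe_ofNormedAddCommGroup,
          BoundedContinuousFunction.coe_add, Pi.add_apply, map_add]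
        exact integral_add (integrable_kernel_apply hK x t) (integrable_kernel_apply hK y t)
      map_smul' := fun c x => by
        ext t
        simp only [BoundedContinuousFunction.coe_ofNormedAddCommGroup,
          BoundedContinuousFunction.coe_smul, map_smul, RingHom.id_apply]
        exact integral_smul c _ }
    (∫ s, ‖K s‖)
    (fun x => (BoundedContinuousFunction.norm_le
      (mul_nonneg (integral_nonneg fun _ => norm_nonneg _) (norm_nonneg _))).2
      (norm_integral_kernel_le hK x))

theorem convOp_apply {K : ℝ → X →L[ℂ] X} (hK : Integrable K) (x : ℝ →ᵇ X) (t : ℝ) :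
    convOp K hK x t = ∫ s, K s (x (t - s)) := rfl

theorem norm_convOp_le {K : ℝ → X →L[ℂ] X} (hK : Integrable K) (x : ℝ →ᵇ X) :
    ‖convOp K hK x‖ ≤ (∫ s, ‖K s‖) * ‖x‖ :=
  (convOp K hK).le_of_opNorm_le
    (LinearMap.mkContinuous_norm_le _ (integral_nonneg fun _ => norm_nonneg _) _) x

/-- The convolution of two operator-valued kernels. -/
noncomputable def kerConv (K J : ℝ → X →L[ℂ] X) (u : ℝ) : X →L[ℂ] X := ∫ s, K s * J (u - s)

theorem integrable_kerConv_integrand {K J : ℝ → X →L[ℂ] X} (hK : Integrable K)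
    (hJ : Integrable J) :
    Integrable (fun p : ℝ × ℝ => K p.2 * J (p.1 - p.2)) (volume.prod volume) :=
  hK.convolution_integrand (ContinuousLinearMap.mul ℂ (X →L[ℂ] X)) hJ

theorem integrable_kerConv {K J : ℝ → X →L[ℂ] X} (hK : Integrable K) (hJ : Integrable J) :
    Integrable (kerConv K J) :=
  hK.integrable_convolution (ContinuousLinearMap.mul ℂ (X →L[ℂ] X)) hJ

theorem convOp_convOp [CompleteSpace X] {K J : ℝ → X →L[ℂ] X} (hK : Integrable K)
    (hJ : Integrable J) (x : ℝ →ᵇ X) :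
    convOp K hK (convOp J hJ x) = convOp (kerConv K J) (integrable_kerConv hK hJ) x := by
  ext t
  have hP := integrable_kerConv_integrand hK hJ
  have key : Integrable (Function.uncurry fun s u : ℝ => (K s * J (u - s)) (x (t - u)))
      (volume.prod volume) := by
    have h1 : Integrable (fun p : ℝ × ℝ => (K p.2 * J (p.1 - p.2)) (x (t - p.1)))
        (volume.prod volume) := by
      refine (hP.norm.mul_const ‖x‖).mono' ?_ (ae_of_all _ fun p =>
        (K p.2 * J (p.1 - p.2)).le_opNorm_of_le (x.norm_coe_le_norm _))
      exact (ContinuousLinearMap.id ℂ (X →L[ℂ] X)).aestronglyMeasurable_comp₂ hP.1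
        (x.continuous.comp (continuous_const.sub continuous_fst)).aestronglyMeasurable
    exact h1.swap
  calc convOp K hK (convOp J hJ x) t
      = ∫ s, ∫ u, (K s * J (u - s)) (x (t - u)) := by
        rw [convOp_apply]
        refine integral_congr_ae (ae_of_all _ fun s => ?_)
        simp only
        rw [convOp_apply, ← integral_sub_right_eq_self (fun r => J r (x (t - s - r))) s,
          ← ContinuousLinearMap.integral_comp_comm]
        · refine integral_congr_ae (ae_of_all _ fun u => ?_)
          simp only [mul_apply_eq_comp]
          congr 3
          ring_nf
        · exact (integrable_kernel_apply hJ x (t - s)).comp_sub_right s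
    _ = ∫ u, ∫ s, (K s * J (u - s)) (x (t - u)) := integral_integral_swap key
    _ = _ := by
        rw [convOp_apply]
        refine integral_congr_ae ?_
        filter_upwards [hP.prod_right_ae] with u hu
        rw [kerConv, ContinuousLinearMap.integral_apply hu]

/-- Both compositions are convolutions with the convolved kernel, and the substitution `s ↦ u - s`
exchanges the two factors. -/
theorem convOp_comm [CompleteSpace X] {K J : ℝ → X →L[ℂ] X} (hK : Integrable K)
    (hJ : Integrable J) (h : ∀ s r, K s * J r = J r * K s) (x : ℝ →ᵇ X) :
    convOp K hK (convOp J hJ x) = convOp J hJ (convOp K hK x) := by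
  rw [convOp_convOp, convOp_convOp]
  congr 1
  congr 1
  ext u : 1
  rw [kerConv, kerConv, ← integral_sub_left_eq_self _ _ u]
  refine integral_congr_ae (ae_of_all _ fun s => ?_)
  simp only
  rw [h, sub_sub_cancel]

theorem integrable_phi_smul (a : ℝ) :
    Integrable fun s => phi a s • (1 : X →L[ℂ] X) := (integrable_phi a).smul_const _

/-- The operator `x ↦ φ_a * x` on `C_b(ℝ, X)`. -/
noncomputable def phiC (a : ℝ) : (ℝ →ᵇ X) →L[ℂ] (ℝ →ᵇ X) :=
  convOp (fun s => phi a s • (1 : X →L[ℂ] X)) (integrable_phi_smul a)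

theorem phiC_apply (a : ℝ) (x : ℝ →ᵇ X) (t : ℝ) : phiC a x t = phiConv a x t := by
  rw [phiC, convOp_apply, phiConv]
  rfl

theorem phiConvNorm_eq (a : ℝ) (x : ℝ →ᵇ X) : phiConvNorm a x = ‖phiC a x‖ₑ := by
  rw [BoundedContinuousFunction.enorm_eq_iSup_enorm, phiConvNorm]
  simp only [phiC_apply]

theorem phiL1_nonneg : 0 ≤ phiL1 := integral_nonneg fun _ => norm_nonneg _

theorem norm_phiC_le (a : ℝ) (x : ℝ →ᵇ X) : ‖phiC a x‖ ≤ phiL1 * ‖x‖ := by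
  refine (norm_convOp_le _ x).trans ?_
  gcongr
  rw [← integral_norm_phi a]
  refine integral_mono (integrable_phi_smul a).norm (integrable_phi a).norm fun s => ?_
  simp only [norm_smul]
  exact mul_le_of_le_one_right (norm_nonneg _) ContinuousLinearMap.norm_id_le

theorem enorm_phiC_le (a : ℝ) (x : ℝ →ᵇ X) : ‖phiC a x‖ₑ ≤ ENNReal.ofReal phiL1 * ‖x‖ₑ := by
  rw [← ofReal_norm, ← ofReal_norm, ← ENNReal.ofReal_mul phiL1_nonneg]
  exact ENNReal.ofReal_le_ofReal (norm_phiC_le a x)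

variable [CompleteSpace X]

theorem convOp_phiC {K : ℝ → X →L[ℂ] X} (hK : Integrable K) (a : ℝ) (x : ℝ →ᵇ X) :
    convOp K hK (phiC a x) = phiC a (convOp K hK x) :=
  convOp_comm _ _ (fun s r => by rw [mul_smul_comm, smul_mul_assoc, mul_one, one_mul]) x

theorem kerConv_phi_synth (a : ℝ) {f : ℝ → X →L[ℂ] X} (hf : Integrable f) :
    kerConv (fun s => phi a s • (1 : X →L[ℂ] X)) (synth f) = synth fun l => ctri (l - a) • f l := by
  ext u : 1
  rw [kerConv]
  simp only [smul_mul_assoc, one_mul]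
  rw [conv_synth (integrable_phi a) hf]
  simp only [ft_phi]

/-- `φ_a * (K * x)` for a kernel `K` with symbol `f` has the symbol `triangle (· - a) f`. -/
theorem phiC_convOp_synth (a : ℝ) {f : ℝ → X →L[ℂ] X} (hf : Integrable f)
    (hs : Integrable (synth f)) (x : ℝ →ᵇ X) :
    ∃ h : Integrable (synth fun l => ctri (l - a) • f l),
      phiC a (convOp (synth f) hs x) = convOp (synth fun l => ctri (l - a) • f l) h x := by
  have e := kerConv_phi_synth a hf
  refine ⟨e ▸ integrable_kerConv (integrable_phi_smul a) hs, ?_⟩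
  rw [phiC, convOp_convOp]
  congr 2

theorem phi_smul_eq_synth (a : ℝ) :
    (fun s => phi a s • (1 : X →L[ℂ] X)) = synth fun l => ctri (l - a) • (1 : X →L[ℂ] X) := by
  ext s : 1
  rw [phi_eq_synth, synth, synth]
  simp only [← smul_assoc]
  rw [integral_smul_const, smul_assoc]

theorem phiC_eq_convOp_synth (b : ℝ) (x : ℝ →ᵇ X) :
    ∃ h : Integrable (synth fun l => ctri (l - b) • (1 : X →L[ℂ] X)),
      phiC b x = convOp _ h x := by
  refine ⟨phi_smul_eq_synth (X := X) b ▸ integrable_phi_smul b, ?_⟩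
  rw [phiC]
  congr 2
  exact phi_smul_eq_synth b

theorem phiC_phiC (a b : ℝ) (x : ℝ →ᵇ X) :
    ∃ h : Integrable (synth fun l => ctri (l - a) • ctri (l - b) • (1 : X →L[ℂ] X)),
      phiC a (phiC b x) = convOp _ h x := by
  obtain ⟨h, e⟩ := phiC_eq_convOp_synth b x
  rw [e]
  exact phiC_convOp_synth a ((integrable_ctri_sub b).smul_const _) h x

/-- The composite multiplier has the product of two triangles as symbol, and triangles with centres
at distance at least `2` have disjoint open supports. -/
theorem phiC_phiC_eq_zero {a b : ℝ} (hab : 2 ≤ |a - b|) (x : ℝ →ᵇ X) :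
    phiC a (phiC b x) = 0 := by
  obtain ⟨h, e⟩ := phiC_phiC a b x
  rw [e]
  ext t
  rw [convOp_apply]
  have : ∀ l : ℝ, ctri (l - a) • ctri (l - b) • (1 : X →L[ℂ] X) = 0 := by
    intro l
    rcases le_or_gt 1 |l - a| with h1 | h1
    · rw [ctri_eq_zero h1, zero_smul]
    · rw [ctri_eq_zero (l := l - b), zero_smul, smul_zero]
      have := abs_sub_le a l b
      rw [abs_sub_comm a l] at this
      linarith
  simp [this, synth]

/-- The triangle at `a` lives on `(a - 1, a + 1)`, which is contained in `(b - 2, b + 1)`, where the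
triangles centred at `b - 2, …, b + 1` sum to one. The real parameter `b` lets the same formula
compare sums with integrals. -/
theorem phiC_eq_sum {a b : ℝ} (h1 : b - 1 ≤ a) (h2 : a ≤ b) (x : ℝ →ᵇ X) :
    phiC a x = ∑ j ∈ Finset.range 4, phiC a (phiC (b - 2 + j) x) := by
  choose h e using fun j : ℕ => phiC_phiC a (b - 2 + j) x
  obtain ⟨h', e'⟩ := phiC_eq_convOp_synth a x
  have hint : ∀ j : ℕ,
      Integrable fun l => ctri (l - a) • ctri (l - (b - 2 + j)) • (1 : X →L[ℂ] X) := by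
    intro j
    refine (integrable_ctri_sub a).norm.mono' ?_ (ae_of_all _ fun l => ?_)
    · have := continuous_ctri
      exact Continuous.aestronglyMeasurable (by fun_prop)
    · rw [norm_smul, norm_smul]
      refine mul_le_of_le_one_right (norm_nonneg _) (mul_le_one₀ ?_ (norm_nonneg _)
        ContinuousLinearMap.norm_id_le)
      rw [ctri, Complex.norm_real, Real.norm_of_nonneg (triangle_nonneg _), triangle_eq]
      exact max_le (by linarith [abs_nonneg (l - (b - 2 + j))]) zero_le_one
  rw [e']
  ext t
  simp only [e, BoundedContinuousFunction.coe_sum, Finset.sum_apply, convOp_apply]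
  rw [← integral_finsetSum _ fun j _ => integrable_kernel_apply (h j) x t]
  refine integral_congr_ae (ae_of_all _ fun s => ?_)
  simp only
  rw [← _root_.sum_apply]
  congr 1
  simp only [synth]
  rw [← Finset.smul_sum, ← integral_finsetSum _ fun j _ => integrable_exp_smul (hint j) s]
  congr 2
  ext l : 1
  rw [← Finset.smul_sum, ← Finset.smul_sum, ← Finset.sum_smul]
  rcases le_or_gt 1 |l - a| with hl | hl
  · rw [ctri_eq_zero hl, zero_smul, zero_smul]
  · rw [abs_lt] at hl
    rw [sum_ctri_eq_one (by linarith) (by linarith), one_smul]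

/-- A bounded function annihilated by all the `φ_a` is zero. -/
theorem eq_zero_of_phiC_eq_zero {x : ℝ →ᵇ X} (h : ∀ a : ℝ, phiC a x = 0) : x = 0 := by
  ext t
  have hint : Integrable fun s => phi 0 s • x (t + 1 - s) :=
    (integrable_kernel_apply (integrable_phi_smul 0) x (t + 1))
  have hcont : Continuous fun s => phi 0 s • x (t + 1 - s) :=
    (continuous_phi 0).smul (x.continuous.comp (by fun_prop))
  -- Modulating `φ_0` gives `φ_a`, so this transform at `v` is `(φ_a * x)(t + 1)` with `a = -2πv`.
  -- Inversion then makes the function itself vanish; its value at `s = 1` is `φ_0(1) x(t)`.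
  have hzero : 𝓕 (fun s => phi 0 s • x (t + 1 - s)) = 0 := by
    ext v
    rw [Real.fourier_eq', Pi.zero_apply]
    have := phiC_apply (-(2 * Real.pi * v)) x (t + 1)
    rw [h, phiConv] at this
    rw [BoundedContinuousFunction.coe_zero, Pi.zero_apply] at this
    rw [this]
    refine integral_congr_ae (ae_of_all _ fun s => ?_)
    simp only
    rw [phi_eq_exp_mul (-(2 * Real.pi * v)), mul_smul]
    congr 2
    simp
    ring
  have := hcont.fourierInv_fourier_eq hint (by rw [hzero]; exact integrable_zero _ _ _)
  have h1 := congrFun this 1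
  rw [hzero, Real.fourierInv_eq'] at h1
  simp only [Pi.zero_apply, smul_zero, integral_zero, add_sub_cancel_right] at h1
  rcases smul_eq_zero.1 h1.symm with h2 | h2
  · exact absurd h2 phi_zero_one_ne_zero
  · simpa using h2

end ConvOp

/-! ### The space `F_as`: equivalence of sum and integral, reconstruction from localized pieces -/

section AsNorm

variable {X : Type*} [NormedAddCommGroup X] [NormedSpace ℂ X]

theorem asNorm_eq (x : ℝ →ᵇ X) : asNorm x = ∑' n : ℤ, 5 * ‖phiC (n : ℝ) x‖ₑ := by
  rw [asNorm, ENNReal.tsum_mul_left]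
  simp only [phiConvNorm_eq]

theorem asNorm_zero : asNorm (0 : ℝ →ᵇ X) = 0 := by simp [asNorm_eq]

theorem asNorm_neg (x : ℝ →ᵇ X) : asNorm (-x) = asNorm x := by simp [asNorm_eq]

theorem asNorm_add_le (x y : ℝ →ᵇ X) : asNorm (x + y) ≤ asNorm x + asNorm y := by
  simp only [asNorm_eq]
  rw [← ENNReal.tsum_add]
  refine ENNReal.tsum_le_tsum fun n => ?_
  rw [← mul_add, map_add]
  gcongr
  exact enorm_add_le _ _

theorem asNorm_sub_le (x y : ℝ →ᵇ X) : asNorm (x - y) ≤ asNorm x + asNorm y := by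
  rw [sub_eq_add_neg, ← asNorm_neg y]
  exact asNorm_add_le _ _

theorem asNorm_smul (c : ℂ) (x : ℝ →ᵇ X) : asNorm (c • x) = ‖c‖ₑ * asNorm x := by
  simp only [asNorm_eq]
  rw [← ENNReal.tsum_mul_left]
  congr 1
  ext n
  rw [map_smul, enorm_smul, mul_left_comm]

/-- A sum of nonnegative continuous functions. Through this, bounds on `asNorm` survive uniform
limits, although `asNorm` may take the value `∞`. -/
theorem lowerSemicontinuous_asNorm : LowerSemicontinuous (asNorm : (ℝ →ᵇ X) → ℝ≥0∞) := by
  rw [funext asNorm_eq]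
  refine lowerSemicontinuous_tsum fun n => Continuous.lowerSemicontinuous ?_
  exact (ENNReal.continuous_const_mul (by simp)).comp (phiC (n : ℝ)).continuous.enorm

theorem asNorm_le_of_tendsto {ι : Type*} {l : Filter ι} [l.NeBot] {f : ι → ℝ →ᵇ X} {x : ℝ →ᵇ X}
    {C : ℝ≥0∞} (hf : Tendsto f l (𝓝 x)) (h : ∀ᶠ i in l, asNorm (f i) ≤ C) : asNorm x ≤ C :=
  (lowerSemicontinuous_asNorm.isClosed_preimage C).mem_of_tendsto hf h

theorem asNorm_sum_le {ι : Type*} (s : Finset ι) (f : ι → ℝ →ᵇ X) :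
    asNorm (∑ i ∈ s, f i) ≤ ∑ i ∈ s, asNorm (f i) := by
  classical
  induction s using Finset.induction_on with
  | empty => simp [asNorm_zero]
  | insert i s hi ih =>
    rw [Finset.sum_insert hi, Finset.sum_insert hi]
    exact (asNorm_add_le _ _).trans (by gcongr)

theorem asNorm_le_tsum {ι : Type*} {f : ι → ℝ →ᵇ X} {x : ℝ →ᵇ X} (hf : HasSum f x) :
    asNorm x ≤ ∑' i, asNorm (f i) :=
  asNorm_le_of_tendsto hf (Eventually.of_forall fun s =>
    (asNorm_sum_le s f).trans (ENNReal.sum_le_tsum s))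

/-- A function whose spectrum lies in a bounded band belongs to `F_as`. -/
theorem asNorm_le_of_band {x : ℝ →ᵇ X} (c : ℤ) (r : ℕ)
    (h : ∀ n : ℤ, (r : ℝ) ≤ |(n : ℝ) - c| → phiC (n : ℝ) x = 0) :
    asNorm x ≤ ((2 * r + 1 : ℕ) : ℝ≥0∞) * (5 * (ENNReal.ofReal phiL1 * ‖x‖ₑ)) := by
  rw [asNorm_eq, tsum_eq_sum (s := Finset.Icc (c - r) (c + r))]
  · refine (Finset.sum_le_card_nsmul _ _ (5 * (ENNReal.ofReal phiL1 * ‖x‖ₑ)) fun n _ => ?_).trans_eq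
      ?_
    · gcongr
      exact enorm_phiC_le _ _
    · rw [Int.card_Icc, nsmul_eq_mul]
      congr 3
      omega
  · intro n hn
    rw [h n, enorm_zero, mul_zero]
    rw [Finset.mem_Icc, not_and_or, not_le, not_le] at hn
    have : (r : ℤ) ≤ |n - c| := by
      rcases hn with hn | hn
      · exact le_abs.2 (Or.inr (by omega))
      · exact le_abs.2 (Or.inl (by omega))
    exact_mod_cast this

/-- Supplies the measurability in `a` needed to integrate `phiConvNorm a x`. -/
theorem lowerSemicontinuous_phiConvNorm (x : ℝ →ᵇ X) :
    LowerSemicontinuous fun a : ℝ => phiConvNorm a x := by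
  refine lowerSemicontinuous_iSup fun t => Continuous.lowerSemicontinuous (Continuous.enorm ?_)
  refine continuous_of_dominated (F := fun a s => phi a s • x (t - s))
    (bound := fun s => ‖phi 0 s‖ * ‖x‖)
    (fun a => (integrable_kernel_apply (integrable_phi_smul a) x t).1)
    (fun a => ae_of_all _ fun s => ?_) ((integrable_phi 0).norm.mul_const _)
    (ae_of_all _ fun s => ?_)
  · rw [norm_smul, norm_phi]
    gcongr
    exact x.norm_coe_le_norm _
  · have h : Continuous fun a : ℝ => Complex.exp (Complex.I * (a : ℂ) * (s : ℂ)) := by fun_prop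
    exact ((h.mul continuous_const).congr fun a => (phi_eq_exp_mul a s).symm).smul continuous_const

theorem lintegral_eq_tsum_Ico (g : ℝ → ℝ≥0∞) :
    ∫⁻ a, g a = ∑' n : ℤ, ∫⁻ a in Set.Ico (n : ℝ) (n + 1), g a := by
  rw [← lintegral_iUnion (fun n => measurableSet_Ico) (Set.pairwise_disjoint_Ico_intCast ℝ),
    iUnion_Ico_intCast, Measure.restrict_univ]

variable [CompleteSpace X]

/-- The comparison behind `memAS_iff`. With `a` an integer and `b` averaged over a unit interval it
bounds the sum by the integral; with `b` an integer and `a` averaged it bounds the integral by the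
sum. -/
theorem phiConvNorm_le {a b : ℝ} (h1 : b - 1 ≤ a) (h2 : a ≤ b) (x : ℝ →ᵇ X) :
    phiConvNorm a x ≤
      ENNReal.ofReal phiL1 * ∑ j ∈ Finset.range 4, phiConvNorm (b - 2 + j) x := by
  simp only [phiConvNorm_eq]
  rw [phiC_eq_sum h1 h2, Finset.mul_sum]
  exact (enorm_sum_le _ _).trans (Finset.sum_le_sum fun j _ => enorm_phiC_le _ _)

theorem MemAS.asNorm_lt_top {x : ℝ →ᵇ X} (hx : MemAS x) : asNorm x < ∞ := by
  have hmeas : Measurable fun a : ℝ => phiConvNorm a x :=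
    (lowerSemicontinuous_phiConvNorm x).measurable
  have h1 : ∑' n : ℤ, phiConvNorm (n : ℝ) x ≤
      ∫⁻ b : ℝ, ENNReal.ofReal phiL1 * ∑ j ∈ Finset.range 4, phiConvNorm (b - 2 + j) x := by
    rw [lintegral_eq_tsum_Ico]
    refine ENNReal.tsum_le_tsum fun n => ?_
    calc phiConvNorm (n : ℝ) x = ∫⁻ _ in Set.Ico (n : ℝ) (n + 1), phiConvNorm (n : ℝ) x := by simp
      _ ≤ _ := setLIntegral_mono' measurableSet_Ico fun b hb =>
        phiConvNorm_le (by linarith [hb.2]) hb.1 x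
  refine ENNReal.mul_lt_top (by simp) (h1.trans_lt ?_)
  have hm : ∀ j : ℕ, Measurable fun b : ℝ => phiConvNorm (b - 2 + j) x := fun j =>
    hmeas.comp ((measurable_id.sub_const 2).add_const (j : ℝ))
  rw [lintegral_const_mul _ (Finset.measurable_fun_sum _ fun j _ => hm j),
    lintegral_finsetSum _ fun j _ => hm j]
  refine ENNReal.mul_lt_top ENNReal.ofReal_lt_top (ENNReal.sum_lt_top.2 fun j _ => ?_)
  have := lintegral_add_right_eq_self (μ := volume) (fun a => phiConvNorm a x) (-2 + (j : ℝ))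
  simp only [← add_assoc, ← sub_eq_add_neg] at this
  rw [this]
  exact hx

theorem memAS_of_asNorm_lt_top {x : ℝ →ᵇ X} (hx : asNorm x < ∞) : MemAS x := by
  have hs : ∑' n : ℤ, phiConvNorm (n : ℝ) x < ∞ := by
    by_contra! h
    rw [asNorm, top_le_iff.1 h] at hx
    simp at hx
  have h1 : ∫⁻ a : ℝ, phiConvNorm a x ≤ ∑' n : ℤ, ENNReal.ofReal phiL1 *
      ∑ j ∈ Finset.range 4, phiConvNorm ((n + 1 : ℝ) - 2 + j) x := by
    rw [lintegral_eq_tsum_Ico]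
    refine ENNReal.tsum_le_tsum fun n => ?_
    calc ∫⁻ a in Set.Ico (n : ℝ) (n + 1), phiConvNorm a x
        ≤ ∫⁻ _ in Set.Ico (n : ℝ) (n + 1), ENNReal.ofReal phiL1 *
          ∑ j ∈ Finset.range 4, phiConvNorm ((n + 1 : ℝ) - 2 + j) x :=
          setLIntegral_mono' measurableSet_Ico fun b hb =>
            phiConvNorm_le (by linarith [hb.1]) hb.2.le x
      _ = _ := by simp
  refine h1.trans_lt ?_
  rw [ENNReal.tsum_mul_left, Summable.tsum_finsetSum fun _ _ => ENNReal.summable]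
  refine ENNReal.mul_lt_top ENNReal.ofReal_lt_top (ENNReal.sum_lt_top.2 fun j _ => ?_)
  have := (Equiv.addRight (-1 + (j : ℤ))).tsum_eq fun n : ℤ => phiConvNorm (n : ℝ) x
  refine lt_of_eq_of_lt ?_ hs
  rw [← this]
  refine tsum_congr fun n => ?_
  rw [Equiv.coe_addRight]
  congr 1
  push_cast
  ring

theorem memAS_iff {x : ℝ →ᵇ X} : MemAS x ↔ asNorm x < ∞ :=
  ⟨MemAS.asNorm_lt_top, memAS_of_asNorm_lt_top⟩

theorem MemAS.add {x y : ℝ →ᵇ X} (hx : MemAS x) (hy : MemAS y) : MemAS (x + y) :=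
  memAS_iff.2 ((asNorm_add_le x y).trans_lt
    (ENNReal.add_lt_top.2 ⟨hx.asNorm_lt_top, hy.asNorm_lt_top⟩))

theorem MemAS.sub {x y : ℝ →ᵇ X} (hx : MemAS x) (hy : MemAS y) : MemAS (x - y) :=
  memAS_iff.2 ((asNorm_sub_le x y).trans_lt
    (ENNReal.add_lt_top.2 ⟨hx.asNorm_lt_top, hy.asNorm_lt_top⟩))

theorem MemAS.smul {x : ℝ →ᵇ X} (c : ℂ) (hx : MemAS x) : MemAS (c • x) :=
  memAS_iff.2 (by
    rw [asNorm_smul]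
    exact ENNReal.mul_lt_top enorm_lt_top hx.asNorm_lt_top)

theorem MemAS.sum {ι : Type*} {s : Finset ι} {f : ι → ℝ →ᵇ X} (h : ∀ i ∈ s, MemAS (f i)) :
    MemAS (∑ i ∈ s, f i) :=
  memAS_iff.2 ((asNorm_sum_le s f).trans_lt
    (ENNReal.sum_lt_top.2 fun i hi => (h i hi).asNorm_lt_top))

theorem tsum_enorm_phiC_lt_top {x : ℝ →ᵇ X} (hx : MemAS x) :
    ∑' n : ℤ, ‖phiC (n : ℝ) x‖ₑ < ∞ := by
  by_contra! h
  have := hx.asNorm_lt_top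
  rw [asNorm_eq, ENNReal.tsum_mul_left, top_le_iff.1 h] at this
  simp at this

theorem summable_norm_phiC {x : ℝ →ᵇ X} (hx : MemAS x) :
    Summable fun n : ℤ => ‖phiC (n : ℝ) x‖ := by
  have := ENNReal.tsum_coe_ne_top_iff_summable.1 (tsum_enorm_phiC_lt_top hx).ne
  exact NNReal.summable_coe.2 this

/-- A function in `F_as` is the sum of its localized parts. -/
theorem hasSum_phiC {x : ℝ →ᵇ X} (hx : MemAS x) :
    HasSum (fun n : ℤ => phiC (n : ℝ) x) x := by
  have hs : Summable fun n : ℤ => phiC (n : ℝ) x := (summable_norm_phiC hx).of_norm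
  -- Each `φ_a` annihilates the difference: by disjoint supports only `n = ⌊a⌋ - 1, …, ⌊a⌋ + 2`
  -- contribute to `φ_a` of the series, and these four terms reproduce `φ_a * x` by `phiC_eq_sum`
  -- with `b = ⌊a⌋ + 1`.
  have : x - ∑' n : ℤ, phiC (n : ℝ) x = 0 := by
    refine eq_zero_of_phiC_eq_zero fun a => ?_
    rw [map_sub, sub_eq_zero, ContinuousLinearMap.map_tsum _ hs,
      phiC_eq_sum (a := a) (b := (⌊a⌋ : ℝ) + 1) (by linarith [Int.floor_le a])
        (Int.lt_floor_add_one a).le,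
      tsum_eq_sum (s := (Finset.range 4).image fun j : ℕ => ⌊a⌋ - 1 + (j : ℤ)),
      Finset.sum_image (by intro i _ j _ hij; simpa using hij)]
    · refine Finset.sum_congr rfl fun j _ => ?_
      congr 2
      push_cast
      ring_nf
    · intro n hn
      refine phiC_phiC_eq_zero ?_ x
      have h1 := Int.floor_le a
      have h2 := (Int.lt_floor_add_one a).le
      have : n ≤ ⌊a⌋ - 2 ∨ ⌊a⌋ + 3 ≤ n := by
        by_contra! hc
        refine hn (Finset.mem_image.2 ⟨(n - (⌊a⌋ - 1)).toNat, ?_, ?_⟩)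
        · rw [Finset.mem_range]; omega
        · omega
      rcases this with h | h
      · have : (n : ℝ) ≤ ⌊a⌋ - 2 := by exact_mod_cast h
        exact le_abs.2 (Or.inl (by linarith))
      · have : (⌊a⌋ : ℝ) + 3 ≤ n := by exact_mod_cast h
        exact le_abs.2 (Or.inr (by linarith))
  rw [sub_eq_zero] at this
  nth_rw 2 [this]
  exact hs.hasSum

/-- The norm of the sum of the pieces is at most the sum of their norms; the factor `5` leaves room.
Outside `F_as` the right side is infinite. -/
theorem enorm_le_asNorm (x : ℝ →ᵇ X) : ‖x‖ₑ ≤ asNorm x := by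
  by_cases hx : MemAS x
  · rw [asNorm_eq, ENNReal.tsum_mul_left]
    nth_rw 1 [← (hasSum_phiC hx).tsum_eq]
    refine enorm_tsum_le_tsum_enorm.trans (le_mul_of_one_le_left' (by norm_num))
  · rw [memAS_iff, not_lt, top_le_iff] at hx
    rw [hx]
    exact le_top

theorem eq_of_asNorm_sub_eq_zero {x y : ℝ →ᵇ X} (h : asNorm (x - y) = 0) : x = y := by
  have := enorm_le_asNorm (x - y)
  rw [h, nonpos_iff_eq_zero, enorm_eq_zero, sub_eq_zero] at this
  exact this

end AsNorm

/-! ### Spectra of products, and polynomials acting on `F_as` -/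

section Multilinear

variable {X : Type*} [NormedAddCommGroup X] [NormedSpace ℂ X]

/-- The function `t ↦ M(x_1(t), …, x_k(t))`. -/
noncomputable def mlComp {k : ℕ} (M : ContinuousMultilinearMap ℂ (fun _ : Fin k => X) X)
    (x : Fin k → ℝ →ᵇ X) : ℝ →ᵇ X :=
  BoundedContinuousFunction.ofNormedAddCommGroup (fun t => M fun i => x i t)
    (M.cont.comp (continuous_pi fun i => (x i).continuous)) (‖M‖ * ∏ i, ‖x i‖)
    (fun t => M.le_opNorm_mul_prod_of_le fun i => (x i).norm_coe_le_norm t)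

theorem mlComp_apply {k : ℕ} (M : ContinuousMultilinearMap ℂ (fun _ : Fin k => X) X)
    (x : Fin k → ℝ →ᵇ X) (t : ℝ) : mlComp M x t = M fun i => x i t := rfl

theorem norm_mlComp_le {k : ℕ} (M : ContinuousMultilinearMap ℂ (fun _ : Fin k => X) X)
    (x : Fin k → ℝ →ᵇ X) : ‖mlComp M x‖ ≤ ‖M‖ * ∏ i, ‖x i‖ :=
  (BoundedContinuousFunction.norm_le (by positivity)).2 fun t =>
    M.le_opNorm_mul_prod_of_le fun i => (x i).norm_coe_le_norm t

theorem mlComp_sum {k : ℕ} (M : ContinuousMultilinearMap ℂ (fun _ : Fin k => X) X) {ι : Type*}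
    (s : Finset ι) (f : ι → ℝ →ᵇ X) :
    mlComp M (fun _ => ∑ m ∈ s, f m) =
      ∑ r ∈ Fintype.piFinset fun _ : Fin k => s, mlComp M fun i => f (r i) := by
  ext t
  simp only [mlComp_apply, BoundedContinuousFunction.coe_sum, Finset.sum_apply]
  exact M.toMultilinearMap.map_sum_finset (fun _ m => f m t) fun _ => s

/-- Needed to pass from finite partial sums of the pieces of `x` to `x` itself. -/
theorem continuous_mlComp_diag {k : ℕ} (M : ContinuousMultilinearMap ℂ (fun _ : Fin k => X) X) :
    Continuous fun x : ℝ →ᵇ X => mlComp M fun _ => x := by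
  rw [continuous_iff_continuousAt]
  intro x
  rw [ContinuousAt, tendsto_iff_norm_sub_tendsto_zero]
  have hb : ∀ y : ℝ →ᵇ X, ‖(mlComp M fun _ => y) - mlComp M fun _ => x‖ ≤
      ‖M‖ * k * max ‖y‖ ‖x‖ ^ (k - 1) * ‖y - x‖ := by
    intro y
    refine (BoundedContinuousFunction.norm_le (by positivity)).2 fun t => ?_
    rw [BoundedContinuousFunction.coe_sub, Pi.sub_apply, mlComp_apply, mlComp_apply]
    refine (M.norm_image_sub_le _ _).trans ?_
    rw [Fintype.card_fin]
    have h1 : ∀ z : ℝ →ᵇ X, ‖fun _ : Fin k => z t‖ ≤ ‖z‖ := fun z =>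
      (pi_norm_le_iff_of_nonneg (norm_nonneg _)).2 fun _ => z.norm_coe_le_norm t
    gcongr
    · exact h1 y
    · exact h1 x
    · exact h1 (y - x)
  refine squeeze_zero (fun _ => norm_nonneg _) hb ?_
  have : Continuous fun y : ℝ →ᵇ X => ‖M‖ * k * max ‖y‖ ‖x‖ ^ (k - 1) * ‖y - x‖ := by fun_prop
  simpa using this.tendsto x

theorem phiC_apply_eq_integral (a : ℝ) (x : ℝ →ᵇ X) (t s : ℝ) :
    phiC a x (t - s) = ∫ u, phi a (u - s) • x (t - u) := by
  rw [phiC_apply, phiConv, ← integral_sub_right_eq_self (fun r => phi a r • x (t - s - r)) s]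
  refine integral_congr_ae (ae_of_all _ fun u => ?_)
  simp only
  congr 2
  ring

/-- A product of kernels averages the transform of `h` over a window of radius `1` about `l + c`.
This is why each factor of a product widens the band by `1`. -/
theorem ft_mul_phi {h : ℝ → ℂ} (hh : Integrable h) (c u l : ℝ) :
    ft (fun s => h s * phi c (u - s)) l
      = synth (fun l' => ft h (l + l') * ctri (l' - c)) u := by
  have hint : Integrable fun s : ℝ => h s * Complex.exp (-(Complex.I * (l : ℂ) * (s : ℂ))) :=
    hh.mul_bdd (c := 1) (Continuous.aestronglyMeasurable (by fun_prop))
      (ae_of_all _ fun s => (norm_exp_neg_I_mul l s).le)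
  have := conv_synth hint (integrable_ctri_sub c) u
  simp only [smul_eq_mul, ← phi_eq_synth] at this
  rw [ft]
  have e : (fun l' : ℝ => ft h (l + l') * ctri (l' - c)) = fun l' : ℝ =>
      ft (fun s => h s * Complex.exp (-(Complex.I * (l : ℂ) * (s : ℂ)))) l' * ctri (l' - c) := by
    ext l'
    rw [ft, ft]
    refine congrArg (· * _) (integral_congr_ae (ae_of_all _ fun s => ?_))
    simp only
    rw [mul_assoc (h s), ← Complex.exp_add]
    congr 2
    push_cast
    ring
  rw [e, ← this]
  refine integral_congr_ae (ae_of_all _ fun s => ?_)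
  simp only
  ring

theorem polyComp_eq_sum (n : ℕ)
    (F : (k : ℕ) → ContinuousMultilinearMap ℂ (fun _ : Fin k => X) X) (x : ℝ →ᵇ X) :
    polyComp n F x = ∑ k ∈ Finset.Icc 1 n, mlComp (F k) fun _ => x := by
  ext t
  simp [polyComp, poly, mlComp_apply]

theorem continuous_polyComp (n : ℕ)
    (F : (k : ℕ) → ContinuousMultilinearMap ℂ (fun _ : Fin k => X) X) :
    Continuous (polyComp n F) := by
  rw [funext (polyComp_eq_sum n F)]
  exact continuous_finsetSum _ fun k _ => continuous_mlComp_diag (F k)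

variable [CompleteSpace X]

/-- If the Fourier transform of `h` vanishes on the sum of the bands of the `φ_{c_i} * g_i`, then `h`
annihilates their product. -/
theorem integral_smul_mlComp_eq_zero {k : ℕ} :
    ∀ (M : ContinuousMultilinearMap ℂ (fun _ : Fin k => X) X) (c : Fin k → ℝ)
      (g : Fin k → ℝ →ᵇ X) (h : ℝ → ℂ), Integrable h →
      (∀ l, |l - ∑ i, c i| ≤ k → ft h l = 0) → ∀ t : ℝ,
      ∫ s, h s • M (fun i => phiC (c i) (g i) (t - s)) = 0 := by
  induction k with
  | zero =>
    intro M c g h hh hft t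
    have h0 := hft 0 (by simp)
    simp only [ft, Complex.ofReal_zero, mul_zero, zero_mul, neg_zero, Complex.exp_zero,
      mul_one] at h0
    have : ∀ s, (fun i : Fin 0 => phiC (c i) (g i) (t - s)) = Fin.elim0 := fun s => by
      ext i; exact i.elim0
    simp only [this]
    rw [integral_smul_const, h0, zero_smul]
  | succ k ih =>
    intro M c g h hh hft t
    set w : ℝ → Fin k → X := fun s i => phiC (c i.succ) (g i.succ) (t - s)
    have hw : Continuous w :=
      continuous_pi fun i => (phiC (c i.succ) (g i.succ)).continuous.comp (by fun_prop)
    have hg : Continuous fun u : ℝ => g 0 (t - u) := (g 0).continuous.comp (by fun_prop)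
    -- The first factor is unfolded as a convolution in which `g 0` is evaluated at a point
    -- independent of `s`. After Fubini, for each fixed `u`, the induction hypothesis applies to the
    -- curried map and the new kernel `h(s) φ_{c 0}(u - s)`.
    have e1 : ∀ s, h s • M (fun i => phiC (c i) (g i) (t - s))
        = ∫ u, (h s * phi (c 0) (u - s)) • M.curryLeft (g 0 (t - u)) (w s) := by
      intro s
      have : M (fun i => phiC (c i) (g i) (t - s)) = M.curryLeft (phiC (c 0) (g 0) (t - s)) (w s) := by
        rw [ContinuousMultilinearMap.curryLeft_apply]
        congr 1
        ext i
        exact Fin.cases rfl (fun _ => rfl) i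
      rw [this, phiC_apply_eq_integral]
      have hi : Integrable fun u => phi (c 0) (u - s) • g 0 (t - u) := by
        have := (integrable_kernel_apply (integrable_phi_smul (c 0)) (g 0) (t - s)).comp_sub_right s
        refine this.congr (ae_of_all _ fun u => ?_)
        change phi (c 0) (u - s) • g 0 (t - s - (u - s)) = _
        congr 2
        ring
      have := ((ContinuousMultilinearMap.apply ℂ (fun _ : Fin k => X) X (w s)).comp
        M.curryLeft).integral_comp_comm hi
      change _ = M.curryLeft _ (w s) at this
      rw [← this, ← integral_smul]
      refine integral_congr_ae (ae_of_all _ fun u => ?_)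
      simp only [map_smul, mul_smul]
      rfl
    simp only [e1]
    have key : Integrable (Function.uncurry fun s u : ℝ =>
        (h s * phi (c 0) (u - s)) • M.curryLeft (g 0 (t - u)) (w s)) (volume.prod volume) := by
      have h1 := (hh.convolution_integrand (ContinuousLinearMap.mul ℂ ℂ)
        (integrable_phi (c 0))).swap
      refine h1.smul_bdd (f := fun p : ℝ × ℝ => M.curryLeft (g 0 (t - p.2)) (w p.1))
        (‖M‖ * ∏ i, ‖(Fin.cons (g 0) (fun i : Fin k => phiC (c i.succ) (g i.succ)) :
          Fin (k + 1) → ℝ →ᵇ X) i‖) ?_ (ae_of_all _ fun p => ?_)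
      · simp only [ContinuousMultilinearMap.curryLeft_apply]
        refine Continuous.aestronglyMeasurable (M.cont.comp ?_)
        exact Continuous.finCons (hg.comp continuous_snd) (hw.comp continuous_fst)
      · rw [ContinuousMultilinearMap.curryLeft_apply]
        refine M.le_opNorm_mul_prod_of_le fun i => ?_
        refine Fin.cases ?_ (fun i => ?_) i
        · exact (g 0).norm_coe_le_norm _
        · exact BoundedContinuousFunction.norm_coe_le_norm _ _
    rw [integral_integral_swap key]
    refine integral_eq_zero_of_ae (ae_of_all _ fun u => ?_)
    refine ih (M.curryLeft (g 0 (t - u))) (fun i => c i.succ) (fun i => g i.succ)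
      (fun s => h s * phi (c 0) (u - s)) ?_ (fun l hl => ?_) t
    · refine hh.mul_bdd (c := 6) ((continuous_phi _).comp (by fun_prop)).aestronglyMeasurable
        (ae_of_all _ fun s => (norm_phi_le _ _).trans ?_)
      have : (1 + (u - s) ^ 2)⁻¹ ≤ 1 := inv_le_one_of_one_le₀ (by nlinarith [sq_nonneg (u - s)])
      linarith
    · rw [ft_mul_phi hh]
      -- Where the triangle is nonzero, `l'` is within `1` of `c 0`, so `l + l'` lies in the band of
      -- radius `k + 1` on which the transform of `h` vanishes.
      have : ∀ l' : ℝ, ft h (l + l') * ctri (l' - c 0) = 0 := by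
        intro l'
        rcases le_or_gt 1 |l' - c 0| with h1 | h1
        · rw [ctri_eq_zero h1, mul_zero]
        · rw [hft, zero_mul]
          rw [Fin.sum_univ_succ, show l + l' - (c 0 + ∑ i : Fin k, c i.succ)
            = (l - ∑ i : Fin k, c i.succ) + (l' - c 0) by ring]
          push_cast
          exact (abs_add_le _ _).trans (add_le_add hl h1.le)
      simp [this, synth]

theorem phiC_mlComp_eq_zero {k : ℕ} (M : ContinuousMultilinearMap ℂ (fun _ : Fin k => X) X)
    (c : Fin k → ℝ) (g : Fin k → ℝ →ᵇ X) {a : ℝ} (ha : (k + 1 : ℝ) ≤ |a - ∑ i, c i|) :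
    phiC a (mlComp M fun i => phiC (c i) (g i)) = 0 := by
  ext t
  rw [phiC_apply, phiConv]
  refine integral_smul_mlComp_eq_zero M c g (phi a) (integrable_phi a) (fun l hl => ?_) t
  rw [ft_phi, ctri_eq_zero]
  have := abs_sub_le a l (∑ i, c i)
  rw [abs_sub_comm a l] at this
  linarith

/-- A partial sum of pieces expands into terms indexed by tuples `r`. Each has spectrum near `∑ i, r
i`, so its norm costs a factor depending only on `k`; the products of norms sum to a `k`-th power.
The bound is uniform in the partial sum and passes to the limit by lower semicontinuity. -/
theorem asNorm_mlComp_le {k : ℕ} (M : ContinuousMultilinearMap ℂ (fun _ : Fin k => X) X)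
    {x : ℝ →ᵇ X} (hx : MemAS x) :
    asNorm (mlComp M fun _ => x) ≤ ((2 * (k + 1) + 1 : ℕ) : ℝ≥0∞) * (5 * (ENNReal.ofReal phiL1 *
      (‖M‖ₑ * (∑' n : ℤ, ‖phiC (n : ℝ) x‖ₑ) ^ k))) := by
  have hlim : Tendsto (fun s : Finset ℤ => mlComp M fun _ => ∑ n ∈ s, phiC (n : ℝ) x) atTop
      (𝓝 (mlComp M fun _ => x)) :=
    ((continuous_mlComp_diag M).tendsto x).comp (hasSum_phiC hx)
  refine asNorm_le_of_tendsto hlim (Eventually.of_forall fun s => ?_)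
  rw [mlComp_sum]
  refine (asNorm_sum_le _ _).trans ?_
  calc ∑ r ∈ Fintype.piFinset fun _ : Fin k => s, asNorm (mlComp M fun i => phiC (r i : ℝ) x)
      ≤ ∑ r ∈ Fintype.piFinset fun _ : Fin k => s, ((2 * (k + 1) + 1 : ℕ) : ℝ≥0∞) *
          (5 * (ENNReal.ofReal phiL1 * (‖M‖ₑ * ∏ i, ‖phiC (r i : ℝ) x‖ₑ))) := by
        refine Finset.sum_le_sum fun r _ => ?_
        refine (asNorm_le_of_band (∑ i, r i) (k + 1) fun n hn => ?_).trans ?_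
        · refine phiC_mlComp_eq_zero M _ _ ?_
          push_cast at hn
          exact hn
        · gcongr
          have := ENNReal.ofReal_le_ofReal (norm_mlComp_le M fun i => phiC (r i : ℝ) x)
          rw [ENNReal.ofReal_mul (norm_nonneg _),
            ENNReal.ofReal_prod_of_nonneg fun _ _ => norm_nonneg _] at this
          simpa only [ofReal_norm] using this
    _ = ((2 * (k + 1) + 1 : ℕ) : ℝ≥0∞) * (5 * (ENNReal.ofReal phiL1 *
          (‖M‖ₑ * (∑ n ∈ s, ‖phiC (n : ℝ) x‖ₑ) ^ k))) := by
        simp only [← Finset.mul_sum]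
        congr 4
        have := (Finset.prod_univ_sum (fun _ : Fin k => s) fun _ (n : ℤ) => ‖phiC (n : ℝ) x‖ₑ)
        rw [← this, Finset.prod_const, Finset.card_univ, Fintype.card_fin]
    _ ≤ _ := by
        gcongr
        exact ENNReal.sum_le_tsum s

theorem MemAS.mlComp_diag {k : ℕ} (M : ContinuousMultilinearMap ℂ (fun _ : Fin k => X) X)
    {x : ℝ →ᵇ X} (hx : MemAS x) : MemAS (mlComp M fun _ => x) := by
  refine memAS_iff.2 ((asNorm_mlComp_le M hx).trans_lt ?_)
  have := ENNReal.pow_lt_top (n := k) (tsum_enorm_phiC_lt_top hx)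
  exact ENNReal.mul_lt_top (ENNReal.natCast_lt_top _) (ENNReal.mul_lt_top (by simp)
    (ENNReal.mul_lt_top (by simp) (ENNReal.mul_lt_top (by simp) this)))

theorem MemAS.polyComp (n : ℕ)
    (F : (k : ℕ) → ContinuousMultilinearMap ℂ (fun _ : Fin k => X) X) {x : ℝ →ᵇ X}
    (hx : MemAS x) : MemAS (polyComp n F x) := by
  rw [polyComp_eq_sum]
  exact MemAS.sum fun k _ => hx.mlComp_diag (F k)

end Multilinear

/-! ### The resolvent on the imaginary axis, and orbits of the semigroup -/

section Semigroup

variable {X : Type*} [NormedAddCommGroup X] [NormedSpace ℂ X] {T : ℝ≥0 → X →L[ℂ] X}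

theorem IsC0Semigroup.exists_bound [CompleteSpace X] (hT : IsC0Semigroup T) (r : ℝ≥0) :
    ∃ C : ℝ, 0 ≤ C ∧ ∀ s ≤ r, ‖T s‖ ≤ C := by
  obtain ⟨C, hC⟩ := banach_steinhaus (g := fun s : Set.Icc (0 : ℝ≥0) r => T s) fun v => by
    obtain ⟨C, hC⟩ := (isCompact_Icc (a := (0 : ℝ≥0)) (b := r)).exists_bound_of_continuousOn
      (hT.strongly_continuous v).continuousOn
    exact ⟨C, fun s => hC s s.2⟩
  exact ⟨C, (norm_nonneg _).trans (hC ⟨0, by simp⟩), fun s hs => hC ⟨s, zero_le, hs⟩⟩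

/-- Local uniform boundedness upgrades strong continuity to joint continuity, which makes the
integrands of all mild formulas continuous or measurable. -/
theorem IsC0Semigroup.continuous_uncurry [CompleteSpace X] (hT : IsC0Semigroup T) :
    Continuous fun p : ℝ≥0 × X => T p.1 p.2 := by
  rw [continuous_iff_continuousAt]
  rintro ⟨s₀, v₀⟩
  obtain ⟨C, -, hC⟩ := hT.exists_bound (s₀ + 1)
  rw [ContinuousAt, tendsto_iff_norm_sub_tendsto_zero]
  have hb : ∀ᶠ p : ℝ≥0 × X in 𝓝 (s₀, v₀),
      ‖T p.1 p.2 - T s₀ v₀‖ ≤ C * ‖p.2 - v₀‖ + ‖T p.1 v₀ - T s₀ v₀‖ := by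
    have : ∀ᶠ p : ℝ≥0 × X in 𝓝 (s₀, v₀), p.1 < s₀ + 1 :=
      continuous_fst.continuousAt.eventually_lt continuousAt_const (by simp)
    filter_upwards [this] with p hp
    rw [← sub_add_sub_cancel (T p.1 p.2) (T p.1 v₀), ← map_sub]
    refine (norm_add_le _ _).trans (add_le_add_left ?_ _)
    exact (T p.1).le_of_opNorm_le (hC _ hp.le) _
  refine squeeze_zero' (Eventually.of_forall fun _ => norm_nonneg _) hb ?_
  have h1 : Continuous fun p : ℝ≥0 × X => C * ‖p.2 - v₀‖ + ‖T p.1 v₀ - T s₀ v₀‖ := by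
    have : Continuous fun p : ℝ≥0 × X => T p.1 v₀ := (hT.strongly_continuous v₀).comp continuous_fst
    exact (continuous_const.mul (continuous_snd.sub continuous_const).norm).add
      (this.sub continuous_const).norm
  simpa using h1.tendsto (s₀, v₀)

theorem IsC0Semigroup.comp_apply (hT : IsC0Semigroup T) {s t : ℝ} (hs : 0 ≤ s) (ht : 0 ≤ t)
    (v : X) : T s.toNNReal (T t.toNNReal v) = T (s + t).toNNReal v := by
  rw [Real.toNNReal_add hs ht, hT.map_add]
  rfl

theorem generator_apply (v : (generator T).domain) : HasGenerator T v (generator T v) :=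
  Classical.choose_spec v.2

theorem HasGenerator.mem_domain {v w : X} (h : HasGenerator T v w) : v ∈ (generator T).domain :=
  ⟨w, h⟩

theorem HasGenerator.semigroup_apply (hT : IsC0Semigroup T) {v w : X} (h : HasGenerator T v w)
    (r : ℝ≥0) : HasGenerator T (T r v) (T r w) := by
  unfold HasGenerator at *
  refine (((T r).continuous.tendsto w).comp h).congr fun s => ?_
  have h1 : T s (T r v) = T r (T s v) := by
    have h2 := congrArg (fun S : X →L[ℂ] X => S v) (hT.map_add s r)
    have h3 := congrArg (fun S : X →L[ℂ] X => S v) (hT.map_add r s)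
    rw [add_comm] at h3
    exact h2.symm.trans h3
  rw [Function.comp_apply, map_smul, map_sub, h1]

/-- Orbits of vectors in the domain of the generator are right-differentiable. -/
theorem HasGenerator.hasDerivWithinAt (hT : IsC0Semigroup T) {v w : X} (h : HasGenerator T v w)
    {t : ℝ} (ht : 0 ≤ t) :
    HasDerivWithinAt (fun τ : ℝ => T τ.toNNReal v) (T t.toNNReal w) (Set.Ioi t) t := by
  rw [hasDerivWithinAt_iff_tendsto_slope' (by simp)]
  have h1 := h.semigroup_apply hT t.toNNReal
  have h2 : Tendsto (fun τ : ℝ => (τ - t).toNNReal) (𝓝[>] t) (𝓝[>] 0) := by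
    refine tendsto_nhdsWithin_iff.2 ⟨?_, ?_⟩
    · have : Continuous fun τ : ℝ => (τ - t).toNNReal := by fun_prop
      simpa using (this.tendsto t).mono_left nhdsWithin_le_nhds
    · filter_upwards [self_mem_nhdsWithin] with τ hτ
      simpa using hτ
  refine (h1.comp h2).congr' ?_
  filter_upwards [self_mem_nhdsWithin] with τ hτ
  have hτ' : 0 ≤ τ - t := by simpa using (le_of_lt hτ : t ≤ τ)
  rw [Function.comp_apply, hT.comp_apply hτ' ht, sub_add_cancel, slope_def_module,
    Real.coe_toNNReal _ hτ', ← Complex.ofReal_inv, Complex.coe_smul]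

/-- `R l` is the resolvent `(A - il)⁻¹` of the generator of `T`, bounded uniformly in `l ∈ ℝ`. -/
structure IsResolventFamily (T : ℝ≥0 → X →L[ℂ] X) (R : ℝ → X →L[ℂ] X) (M : ℝ) : Prop where
  resolvent : ∀ l : ℝ, IsResolventAt (generator T) (Complex.I * l) (R l)
  bound : ∀ l, ‖R l‖ ≤ M

theorem exists_isResolventFamily (hspec : opSpectrum (generator T) ∩ imagAxis = ∅)
    (hres : ResolventBddOnImagAxis (generator T)) : ∃ R M, IsResolventFamily T R M := by
  have hax : ∀ l : ℝ, Complex.I * l ∈ imagAxis := fun l => by simp [imagAxis]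
  have : ∀ l : ℝ, ∃ R, IsResolventAt (generator T) (Complex.I * l) R := by
    intro l
    by_contra hc
    have : Complex.I * l ∈ opSpectrum (generator T) ∩ imagAxis := ⟨hc, hax l⟩
    rw [hspec] at this
    exact this
  choose R hR using this
  obtain ⟨M, hM⟩ := hres
  exact ⟨R, M, hR, fun l => hM _ (hax l) _ (hR l)⟩

variable {R : ℝ → X →L[ℂ] X} {M : ℝ}

namespace IsResolventFamily

theorem nonneg (hR : IsResolventFamily T R M) : 0 ≤ M := (norm_nonneg _).trans (hR.bound 0)

theorem hasGenerator (hR : IsResolventFamily T R M) (l : ℝ) (v : X) :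
    HasGenerator T (R l v) (v + (Complex.I * l) • R l v) := by
  obtain ⟨h, e⟩ := (hR.resolvent l).1 v
  have := generator_apply ⟨R l v, h⟩
  rwa [sub_eq_iff_eq_add.1 e] at this

theorem apply_of_hasGenerator (hR : IsResolventFamily T R M) (l : ℝ) {v w : X}
    (h : HasGenerator T v w) : R l (w - (Complex.I * l) • v) = v := by
  have := (hR.resolvent l).2 ⟨v, h.mem_domain⟩
  rwa [(generator_apply ⟨v, h.mem_domain⟩).unique h] at this

theorem comm (hR : IsResolventFamily T R M) (hT : IsC0Semigroup T) (l : ℝ) (r : ℝ≥0) (v : X) :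
    T r (R l v) = R l (T r v) := by
  have := hR.apply_of_hasGenerator l ((hR.hasGenerator l v).semigroup_apply hT r)
  rw [map_add, map_smul, add_sub_cancel_right] at this
  exact this.symm

/-- The resolvent identity. With the uniform bound it gives continuity of `R`, then
differentiability with derivative `i R²`, so every derivative is again bounded. -/
theorem sub_eq (hR : IsResolventFamily T R M) (l l' : ℝ) :
    R l - R l' = (Complex.I * (l - l')) • (R l * R l') := by
  ext v
  have := hR.apply_of_hasGenerator l (hR.hasGenerator l' v)
  rw [add_sub_assoc, ← sub_smul, map_add, map_smul] at this
  simp only [sub_apply, smul_apply, mul_apply_eq_comp]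
  nth_rw 1 [← this]
  module

theorem continuous (hR : IsResolventFamily T R M) : Continuous R := by
  rw [continuous_iff_continuousAt]
  intro l
  rw [ContinuousAt, tendsto_iff_norm_sub_tendsto_zero]
  have hb : ∀ l', ‖R l' - R l‖ ≤ |l' - l| * (M * M) := by
    intro l'
    rw [hR.sub_eq, norm_smul, norm_mul, Complex.norm_I, one_mul, ← Complex.ofReal_sub,
      Complex.norm_real, Real.norm_eq_abs]
    gcongr
    exact (norm_mul_le _ _).trans
      (mul_le_mul (hR.bound _) (hR.bound _) (norm_nonneg _) hR.nonneg)
  refine squeeze_zero (fun _ => norm_nonneg _) hb ?_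
  have : Continuous fun l' : ℝ => |l' - l| * (M * M) := by fun_prop
  simpa using this.tendsto l

theorem hasDerivAt (hR : IsResolventFamily T R M) (l : ℝ) :
    HasDerivAt R (Complex.I • (R l * R l)) l := by
  rw [hasDerivAt_iff_tendsto_slope]
  have h0 : Continuous fun l' => R l' * R l := hR.continuous.mul continuous_const
  have h1 : Continuous fun l' => Complex.I • (R l' * R l) := h0.const_smul Complex.I
  refine ((h1.tendsto l).mono_left nhdsWithin_le_nhds).congr' ?_
  filter_upwards [self_mem_nhdsWithin] with l' hl'
  have : (l' : ℂ) - l ≠ 0 := sub_ne_zero.2 (by exact_mod_cast hl')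
  rw [slope_def_module, hR.sub_eq, ← Complex.coe_smul, smul_smul]
  congr 1
  push_cast
  field_simp

theorem integrable_ctri_smul (hR : IsResolventFamily T R M) (a : ℝ) :
    Integrable fun l => ctri (l - a) • R l := by
  refine ((integrable_ctri_sub a).norm.mul_const M).mono' ?_ (ae_of_all _ fun l => ?_)
  · exact ((continuous_ctri.comp (by fun_prop)).smul hR.continuous).aestronglyMeasurable
  · rw [norm_smul]
    gcongr
    exact hR.bound l

theorem synth_ctri_smul_apply (hR : IsResolventFamily T R M) (a t : ℝ) (v : X) :
    synth (fun l => ctri (l - a) • R l) t v = synth (fun l => ctri (l - a) • R l v) t := by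
  rw [synth, synth, smul_apply,
    ContinuousLinearMap.integral_apply (integrable_exp_smul (hR.integrable_ctri_smul a) t)]
  rfl

end IsResolventFamily

variable [CompleteSpace X]

theorem IsC0Semigroup.continuous_apply {α : Type*} [TopologicalSpace α] (hT : IsC0Semigroup T)
    {f : α → ℝ} {g : α → X} (hf : Continuous f) (hg : Continuous g) :
    Continuous fun a => T (f a).toNNReal (g a) :=
  hT.continuous_uncurry.comp ((continuous_real_toNNReal.comp hf).prodMk hg)

namespace IsResolventFamily

/-- Since `(A - il) R l v = v`, the right derivative of `e^{-ilτ} T(τ) R l v` is `e^{-ilτ} T(τ) v`;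
one-sided derivatives suffice for the fundamental theorem of calculus. -/
theorem exp_smul_semigroup_sub (hR : IsResolventFamily T R M) (hT : IsC0Semigroup T) (l : ℝ)
    {b : ℝ} (hb : 0 ≤ b) (v : X) :
    Complex.exp (-(Complex.I * l * b)) • T b.toNNReal (R l v) - R l v
      = ∫ τ in (0 : ℝ)..b, Complex.exp (-(Complex.I * l * τ)) • T τ.toNNReal v := by
  have hexp : Continuous fun τ : ℝ => Complex.exp (-(Complex.I * l * τ)) := by fun_prop
  rw [intervalIntegral.integral_eq_sub_of_hasDeriv_right
    (f := fun τ : ℝ => Complex.exp (-(Complex.I * l * τ)) • T τ.toNNReal (R l v))]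
  · simp [hT.map_zero]
  · exact (hexp.smul (hT.continuous_apply continuous_id continuous_const)).continuousOn
  · intro τ hτ
    rw [min_eq_left hb] at hτ
    have h1 : HasDerivAt (fun τ : ℝ => Complex.exp (-(Complex.I * l * τ)))
        (Complex.exp (-(Complex.I * l * τ)) * -(Complex.I * l * 1)) τ :=
      (((Complex.ofRealCLM.hasDerivAt (x := τ)).const_mul (Complex.I * (l : ℂ))).neg).cexp
    refine (h1.hasDerivWithinAt.smul
      ((hR.hasGenerator l v).hasDerivWithinAt hT hτ.1.le)).congr_deriv ?_
    rw [map_add, map_smul]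
    module
  · exact (hexp.smul (hT.continuous_apply continuous_id continuous_const)).intervalIntegrable _ _

/-- The exponential `τ ↦ e^{ilτ} R(il) v` is a mild solution with right side `e^{ilτ} v`. -/
theorem mild_exp (hR : IsResolventFamily T R M) (hT : IsC0Semigroup T) (l : ℝ) {s t : ℝ}
    (hst : s ≤ t) (v : X) :
    Complex.exp (Complex.I * l * t) • R l v
      = T (t - s).toNNReal (Complex.exp (Complex.I * l * s) • R l v)
        - ∫ τ in s..t, T (t - τ).toNNReal (Complex.exp (Complex.I * l * τ) • v) := by
  have h := hR.exp_smul_semigroup_sub hT l (sub_nonneg.2 hst) v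
  have h2 : ∫ τ in s..t, T (t - τ).toNNReal (Complex.exp (Complex.I * l * τ) • v)
      = Complex.exp (Complex.I * l * t) •
        ∫ τ in (0 : ℝ)..(t - s), Complex.exp (-(Complex.I * l * τ)) • T τ.toNNReal v := by
    have := intervalIntegral.integral_comp_sub_left (a := s) (b := t)
      (fun τ : ℝ => Complex.exp (-(Complex.I * l * τ)) • T τ.toNNReal v) t
    rw [sub_self] at this
    rw [← this, ← intervalIntegral.integral_smul]
    congr 1
    ext τ
    rw [map_smul, smul_smul, ← Complex.exp_add]
    congr 2
    push_cast
    ring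
  rw [h2, ← h, smul_sub, smul_smul, ← Complex.exp_add, map_smul]
  have : Complex.I * l * t + -(Complex.I * l * ((t - s : ℝ) : ℂ)) = Complex.I * l * s := by
    push_cast; ring
  rw [this]
  abel

/-- The truncated Fourier transform of a bounded orbit of `T` consists of boundary terms. -/
theorem integral_exp_orbit (hR : IsResolventFamily T R M) (hT : IsC0Semigroup T) {w : ℝ → X}
    (hw : ∀ s t, s ≤ t → w t = T (t - s).toNNReal (w s)) (l : ℝ) {a b : ℝ} (hab : a ≤ b) :
    ∫ τ in a..b, Complex.exp (-(Complex.I * l * τ)) • w τ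
      = Complex.exp (-(Complex.I * l * b)) • R l (w b)
        - Complex.exp (-(Complex.I * l * a)) • R l (w a) := by
  have h := hR.exp_smul_semigroup_sub hT l (sub_nonneg.2 hab) (w a)
  rw [hR.comm hT, ← hw a b hab] at h
  have h2 : ∫ τ in a..b, Complex.exp (-(Complex.I * l * τ)) • w τ
      = Complex.exp (-(Complex.I * l * a)) •
        ∫ τ in (0 : ℝ)..(b - a), Complex.exp (-(Complex.I * l * τ)) • T τ.toNNReal (w a) := by
    have := intervalIntegral.integral_comp_sub_right (a := a) (b := b)
      (fun τ : ℝ => Complex.exp (-(Complex.I * l * τ)) • T τ.toNNReal (w a)) a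
    rw [sub_self] at this
    rw [← this, ← intervalIntegral.integral_smul]
    refine intervalIntegral.integral_congr fun τ hτ => ?_
    rw [Set.uIcc_of_le hab] at hτ
    rw [hw a τ hτ.1, smul_smul, ← Complex.exp_add]
    congr 2
    push_cast
    ring
  rw [h2, ← h, smul_sub, smul_smul, ← Complex.exp_add]
  congr 3
  push_cast
  ring

/-- Writing `φ_c` as a Fourier integral and exchanging integrals leaves the truncated transform of
`w`, which `integral_exp_orbit` reduces to its endpoints. What remains is one fixed kernel acting on
`w b` and `w a`. -/
theorem integral_phi_orbit (hR : IsResolventFamily T R M) (hT : IsC0Semigroup T) {w : ℝ →ᵇ X}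
    (hw : ∀ s t, s ≤ t → w t = T (t - s).toNNReal (w s)) (c t : ℝ) {a b : ℝ} (hab : a ≤ b) :
    ∫ τ in a..b, phi c (t - τ) • w τ
      = synth (fun l => ctri (l - c) • R l) (t - b) (w b)
        - synth (fun l => ctri (l - c) • R l) (t - a) (w a) := by
  have hshift : ∀ r : ℝ, synth (fun l => ctri (l - c) • R l) (t - r) (w r)
      = synth (fun l => ctri (l - c) • Complex.exp (-(Complex.I * l * r)) • R l (w r)) t := by
    intro r
    rw [hR.synth_ctri_smul_apply, synth, synth]
    refine congrArg _ (integral_congr_ae (ae_of_all _ fun l => ?_))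
    simp only
    rw [smul_comm (ctri _) (Complex.exp _), smul_smul (Complex.exp _) (Complex.exp _),
      ← Complex.exp_add]
    congr 2
    push_cast
    ring
  have hint : ∀ r : ℝ, Integrable fun l : ℝ =>
      ctri (l - c) • Complex.exp (-(Complex.I * l * r)) • R l (w r) := by
    intro r
    refine ((integrable_ctri_sub c).norm.mul_const (M * ‖w r‖)).mono' ?_ (ae_of_all _ fun l => ?_)
    · have h1 : Continuous fun l : ℝ => Complex.exp (-(Complex.I * l * r)) := by fun_prop
      exact ((continuous_ctri.comp (by fun_prop)).smul
        (h1.smul (hR.continuous.clm_apply continuous_const))).aestronglyMeasurable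
    · rw [norm_smul, norm_smul, norm_exp_neg_I_mul, one_mul]
      gcongr
      exact (R l).le_of_opNorm_le (hR.bound l) _
  have hsub : synth (fun l => ctri (l - c) • R l) (t - b) (w b)
        - synth (fun l => ctri (l - c) • R l) (t - a) (w a)
      = synth (fun l => ctri (l - c) •
          ∫ τ in a..b, Complex.exp (-(Complex.I * l * τ)) • w τ) t := by
    rw [hshift, hshift, synth, synth, synth, ← smul_sub,
      ← integral_sub (integrable_exp_smul (hint b) t) (integrable_exp_smul (hint a) t)]
    refine congrArg _ (integral_congr_ae (ae_of_all _ fun l => ?_))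
    simp only
    rw [hR.integral_exp_orbit hT hw l hab, smul_sub, smul_sub]
  rw [hsub, intervalIntegral.integral_of_le hab]
  have key : Integrable (Function.uncurry fun τ l : ℝ =>
      (1 / (2 * Real.pi) : ℂ) • Complex.exp (Complex.I * (l : ℂ) * ((t - τ : ℝ) : ℂ)) •
        ctri (l - c) • w τ) ((volume.restrict (Set.Ioc a b)).prod volume) := by
    have h2 : Integrable (fun p : ℝ × ℝ => ctri (p.2 - c) • w p.1)
        ((volume.restrict (Set.Ioc a b)).prod volume) := by
      have h3 : Integrable (fun τ => w τ) (volume.restrict (Set.Ioc a b)) :=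
        Integrable.of_bound (C := ‖w‖) w.continuous.aestronglyMeasurable
          (ae_of_all _ fun p => w.norm_coe_le_norm _)
      exact ((integrable_ctri_sub c).smul_prod h3).swap
    have h4 : Continuous fun p : ℝ × ℝ =>
        Complex.exp (Complex.I * (p.2 : ℂ) * ((t - p.1 : ℝ) : ℂ)) := by fun_prop
    exact (h2.bdd_smul 1 h4.aestronglyMeasurable (ae_of_all _ fun p =>
      (norm_exp_I_mul _ _).le)).smul (1 / (2 * Real.pi) : ℂ)
  calc ∫ τ in Set.Ioc a b, phi c (t - τ) • w τ
      = ∫ τ in Set.Ioc a b, ∫ l : ℝ, (1 / (2 * Real.pi) : ℂ) •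
          Complex.exp (Complex.I * (l : ℂ) * ((t - τ : ℝ) : ℂ)) • ctri (l - c) • w τ := by
        refine integral_congr_ae (ae_of_all _ fun τ => ?_)
        simp only
        rw [phi_eq_synth, synth, integral_smul, smul_assoc, ← integral_smul_const]
        simp only [smul_assoc]
    _ = ∫ l : ℝ, ∫ τ in Set.Ioc a b, (1 / (2 * Real.pi) : ℂ) •
          Complex.exp (Complex.I * (l : ℂ) * ((t - τ : ℝ) : ℂ)) • ctri (l - c) • w τ :=
        integral_integral_swap key
    _ = _ := by
        rw [synth, ← integral_smul]
        refine integral_congr_ae (ae_of_all _ fun l => ?_)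
        simp only
        rw [intervalIntegral.integral_of_le hab, integral_smul, ← integral_smul (ctri _),
          ← integral_smul (Complex.exp _)]
        refine congrArg _ (integral_congr_ae (ae_of_all _ fun τ => ?_))
        simp only
        rw [smul_comm (ctri _) (Complex.exp (-_)), smul_smul (Complex.exp _) (Complex.exp _),
          ← Complex.exp_add]
        congr 2
        push_cast
        ring

/-- A bounded orbit of `T` on the whole line vanishes. -/
theorem eq_zero_of_orbit (hR : IsResolventFamily T R M) (hT : IsC0Semigroup T) {w : ℝ →ᵇ X}
    (hw : ∀ s t, s ≤ t → w t = T (t - s).toNNReal (w s)) : w = 0 := by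
  refine eq_zero_of_phiC_eq_zero fun c => ?_
  ext t
  rw [phiC_apply, BoundedContinuousFunction.coe_zero, Pi.zero_apply, phiConv,
    ← integral_sub_left_eq_self _ _ t]
  simp only [sub_sub_cancel]
  have hint : Integrable fun τ => phi c (t - τ) • w τ := by
    have := (integrable_kernel_apply (integrable_phi_smul c) w t).comp_sub_left t
    simpa using this
  have h1 := intervalIntegral_tendsto_integral hint tendsto_neg_atTop_atBot
    (tendsto_id (α := ℝ) (x := atTop))
  refine tendsto_nhds_unique h1 ?_
  set H := synth fun l => ctri (l - c) • R l
  have hH : Tendsto H (cocompact ℝ) (𝓝 0) := tendsto_synth_cocompact _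
  -- The kernel decays in operator norm and `w` is bounded, so both endpoint terms vanish as the
  -- interval exhausts the line.
  have hgo : ∀ r : ℝ → ℝ, Tendsto (fun b => t - r b) atTop (cocompact ℝ) →
      Tendsto (fun b => H (t - r b) (w (r b))) atTop (𝓝 0) := by
    intro r hr
    rw [tendsto_zero_iff_norm_tendsto_zero]
    have h2 := ((hH.comp hr).norm).mul_const ‖w‖
    rw [norm_zero, zero_mul] at h2
    exact squeeze_zero (fun _ => norm_nonneg _)
      (fun b => (H (t - r b)).le_opNorm_of_le (w.norm_coe_le_norm _)) h2
  have h3 : Tendsto (fun b : ℝ => H (t - b) (w b) - H (t - -b) (w (-b))) atTop (𝓝 0) := by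
    have e1 := hgo id ((tendsto_atBot_add_const_left _ t tendsto_neg_atTop_atBot).mono_right
      atBot_le_cocompact |>.congr fun b => (sub_eq_add_neg t b).symm)
    have e2 := hgo Neg.neg ((tendsto_atTop_add_const_left _ t tendsto_id).mono_right
      atTop_le_cocompact |>.congr fun b => (sub_neg_eq_add t b).symm)
    simpa using e1.sub e2
  refine h3.congr' ?_
  filter_upwards [eventually_ge_atTop 0] with b hb
  exact (hR.integral_phi_orbit hT hw c t (by linarith)).symm

end IsResolventFamily

end Semigroup

/-! ### Kernels for the localized resolvent, uniformly bounded in `L¹` -/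

section KernelBound

theorem integrable_of_forall_abs_sub {E : Type*} [NormedAddCommGroup E] {f : ℝ → E} {c r : ℝ}
    (hf : Continuous f) (h : ∀ l, r ≤ |l - c| → f l = 0) : Integrable f := by
  refine hf.integrable_of_hasCompactSupport
    (HasCompactSupport.of_support_subset_isCompact (isCompact_closedBall c r) fun l hl => ?_)
  rw [Metric.mem_closedBall, Real.dist_eq]
  by_contra! hc
  exact hl (h l hc.le)

theorem integral_norm_le_of_forall_abs_sub {E : Type*} [NormedAddCommGroup E] {f : ℝ → E}
    {c r C : ℝ} (hr : 0 ≤ r) (hf : Integrable f) (h : ∀ l, r ≤ |l - c| → f l = 0)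
    (hb : ∀ l, ‖f l‖ ≤ C) : ∫ l, ‖f l‖ ≤ 2 * r * C := by
  calc ∫ l, ‖f l‖ = ∫ l in Set.Icc (c - r) (c + r), ‖f l‖ := by
        rw [setIntegral_eq_integral_of_forall_compl_eq_zero]
        intro l hl
        rw [h l, norm_zero]
        by_contra! hc
        rw [abs_lt] at hc
        exact hl ⟨by linarith [hc.1], by linarith [hc.2]⟩
    _ ≤ ∫ l in Set.Icc (c - r) (c + r), C :=
        setIntegral_mono hf.norm.integrableOn (by simp) hb
    _ = 2 * r * C := by
        rw [setIntegral_const, Measure.real, Real.volume_Icc,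
          ENNReal.toReal_ofReal (by linarith), smul_eq_mul]
        ring

/-- The `L¹`-norm of the inverse Fourier transform of a `C²` function with bounded support. -/
theorem integral_norm_synth_le {E : Type*} [NormedAddCommGroup E] [NormedSpace ℂ E]
    {f f' f'' : ℝ → E} {c r C : ℝ} (hr : 0 ≤ r)
    (hf : ∀ l, HasDerivAt f (f' l) l) (hf' : ∀ l, HasDerivAt f' (f'' l) l) (hf'' : Continuous f'')
    (h : ∀ l, r ≤ |l - c| → f l = 0) (h' : ∀ l, r ≤ |l - c| → f' l = 0)
    (h'' : ∀ l, r ≤ |l - c| → f'' l = 0) (hb : ∀ l, ‖f l‖ ≤ C) (hb'' : ∀ l, ‖f'' l‖ ≤ C) :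
    Integrable (synth f) ∧ ∫ t, ‖synth f t‖ ≤ 4 * r * C * Real.pi := by
  have i0 : Integrable f := integrable_of_forall_abs_sub
    (continuous_iff_continuousAt.2 fun l => (hf l).continuousAt) h
  have i1 : Integrable f' := integrable_of_forall_abs_sub
    (continuous_iff_continuousAt.2 fun l => (hf' l).continuousAt) h'
  have i2 : Integrable f'' := integrable_of_forall_abs_sub hf'' h''
  have d1 : deriv f = f' := funext fun l => (hf l).deriv
  have d2 : deriv f' = f'' := funext fun l => (hf' l).deriv
  have F1 := Real.fourier_deriv i0 (fun l => (hf l).differentiableAt) (d1 ▸ i1)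
  have F2 := Real.fourier_deriv i1 (fun l => (hf' l).differentiableAt) (d2 ▸ i2)
  rw [d1] at F1
  rw [d2, F1] at F2
  -- Two derivatives of the symbol buy decay of order `t⁻²`. Both `f` and `f''` have `L¹`-norm at
  -- most `2rC`, hence the constant `4rC` below; the integral of `(1 + t²)⁻¹` contributes `π`.
  have hsq : ∀ t : ℝ, ‖synth f'' t‖ = t ^ 2 * ‖synth f t‖ := by
    intro t
    have hpi : (Real.pi : ℂ) ≠ 0 := by exact_mod_cast Real.pi_ne_zero
    have : synth f'' t = (-((t ^ 2 : ℝ) : ℂ)) • synth f t := by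
      rw [synth_eq_fourier, synth_eq_fourier, F2]
      simp only [smul_smul]
      congr 1
      push_cast
      field_simp
      rw [Complex.I_sq]
      ring
    rw [this, norm_smul, norm_neg, Complex.norm_real, Real.norm_of_nonneg (sq_nonneg t)]
  have hpt : ∀ t : ℝ, ‖synth f t‖ ≤ 4 * r * C * (1 + t ^ 2)⁻¹ := by
    intro t
    rw [← div_eq_mul_inv, le_div_iff₀ (by positivity)]
    have e1 := (norm_synth_le f t).trans (integral_norm_le_of_forall_abs_sub hr i0 h hb)
    have e2 := (norm_synth_le f'' t).trans (integral_norm_le_of_forall_abs_sub hr i2 h'' hb'')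
    rw [hsq] at e2
    linarith
  have hi : Integrable (synth f) := (integrable_inv_one_add_sq.const_mul _).mono'
    (continuous_synth i0).aestronglyMeasurable (ae_of_all _ hpt)
  refine ⟨hi, (integral_mono hi.norm (integrable_inv_one_add_sq.const_mul _) hpt).trans_eq ?_⟩
  rw [integral_const_mul, integral_univ_inv_one_add_sq]

/-- A smooth cut-off function, together with its first two derivatives. -/
theorem exists_cutoff : ∃ (ψ ψ' ψ'' : ℝ → ℝ) (b : ℝ),
    (∀ l, HasDerivAt ψ (ψ' l) l) ∧ (∀ l, HasDerivAt ψ' (ψ'' l) l) ∧ Continuous ψ'' ∧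
    (∀ l, |l| ≤ 1 → ψ l = 1) ∧
    (∀ l, 3 ≤ |l| → ψ l = 0 ∧ ψ' l = 0 ∧ ψ'' l = 0) ∧
    (∀ l, |ψ l| ≤ b ∧ |ψ' l| ≤ b ∧ |ψ'' l| ≤ b) := by
  -- The support radius is `2`, strictly below `3`, so both derivatives also vanish wherever `3 ≤
  -- |l|`.
  let ψ : ContDiffBump (0 : ℝ) := ⟨1, 2, by norm_num, by norm_num⟩
  have h2 : ContDiff ℝ 2 ψ := ψ.contDiff
  have h1 : ContDiff ℝ 1 (deriv ψ) := ((contDiff_succ_iff_deriv (n := 1)).1 h2).2.2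
  have h0 : Continuous (deriv (deriv ψ)) := h1.continuous_deriv le_rfl
  have c0 : HasCompactSupport ψ := ψ.hasCompactSupport
  obtain ⟨b0, hb0⟩ := c0.exists_bound_of_continuous h2.continuous
  obtain ⟨b1, hb1⟩ := c0.deriv.exists_bound_of_continuous h1.continuous
  obtain ⟨b2, hb2⟩ := c0.deriv.deriv.exists_bound_of_continuous h0
  have hts : ∀ l : ℝ, 3 ≤ |l| → l ∉ tsupport ψ := by
    intro l hl hl'
    rw [ψ.tsupport_eq, mem_closedBall_zero_iff, Real.norm_eq_abs] at hl'
    change |l| ≤ 2 at hl'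
    linarith
  refine ⟨ψ, deriv ψ, deriv (deriv ψ), max b0 (max b1 b2),
    fun l => ((h2.differentiable two_ne_zero) l).hasDerivAt,
    fun l => ((h1.differentiable one_ne_zero) l).hasDerivAt, h0, fun l hl => ?_,
    fun l hl => ⟨?_, ?_, ?_⟩, fun l => ⟨(hb0 l).trans (le_max_left _ _), (hb1 l).trans ?_,
      (hb2 l).trans ?_⟩⟩
  · exact ψ.one_of_mem_closedBall (by rw [mem_closedBall_zero_iff]; exact hl)
  · exact image_eq_zero_of_notMem_tsupport (hts l hl)
  · exact Function.notMem_support.1 fun hc => hts l hl (support_deriv_subset hc)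
  · exact Function.notMem_support.1 fun hc => hts l hl
      (closure_minimal support_deriv_subset (isClosed_tsupport _) (support_deriv_subset hc))
  · exact (le_max_left _ _).trans (le_max_right _ _)
  · exact (le_max_right _ _).trans (le_max_right _ _)

variable {X : Type*} [NormedAddCommGroup X] [NormedSpace ℂ X] {T : ℝ≥0 → X →L[ℂ] X}
  {R : ℝ → X →L[ℂ] X} {M : ℝ}

/-- Kernels whose symbols agree with the resolvent on unit neighbourhoods of `a`, uniformly bounded in
`L¹`. -/
theorem IsResolventFamily.exists_kernel (hR : IsResolventFamily T R M) :
    ∃ (ψ : ℝ → ℝ) (C : ℝ), (∀ l, |l| ≤ 1 → ψ l = 1) ∧ ∀ a : ℝ,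
      Integrable (fun l => ψ (l - a) • R l) ∧ Integrable (synth fun l => ψ (l - a) • R l) ∧
        ∫ t, ‖synth (fun l => ψ (l - a) • R l) t‖ ≤ C := by
  obtain ⟨ψ, ψ', ψ'', b, hψ, hψ', cψ'', hone, hzero, hb⟩ := exists_cutoff
  have hM := hR.nonneg
  have hb0 : 0 ≤ b := (abs_nonneg _).trans (hb 0).1
  set R1 : ℝ → X →L[ℂ] X := fun l => Complex.I • (R l * R l)
  set R2 : ℝ → X →L[ℂ] X := fun l => Complex.I • (R1 l * R l + R l * R1 l)
  have dR : ∀ l, HasDerivAt R (R1 l) l := hR.hasDerivAt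
  have dR1 : ∀ l, HasDerivAt R1 (R2 l) l := fun l => ((dR l).mul (dR l)).const_smul Complex.I
  have cR := hR.continuous
  have cRR : Continuous fun l => R l * R l := cR.mul cR
  have cR1 : Continuous R1 := cRR.const_smul Complex.I
  have cR2' : Continuous fun l => R1 l * R l + R l * R1 l := (cR1.mul cR).add (cR.mul cR1)
  have cR2 : Continuous R2 := cR2'.const_smul Complex.I
  have bR1 : ∀ l, ‖R1 l‖ ≤ M * M := fun l => by
    rw [norm_smul, Complex.norm_I, one_mul]
    exact (norm_mul_le _ _).trans (mul_le_mul (hR.bound _) (hR.bound _) (norm_nonneg _) hM)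
  have bR2 : ∀ l, ‖R2 l‖ ≤ M * M * M + M * (M * M) := fun l => by
    rw [norm_smul, Complex.norm_I, one_mul]
    refine (norm_add_le _ _).trans (add_le_add ((norm_mul_le _ _).trans ?_)
      ((norm_mul_le _ _).trans ?_))
    · exact mul_le_mul (bR1 _) (hR.bound _) (norm_nonneg _) (mul_nonneg hM hM)
    · exact mul_le_mul (hR.bound _) (bR1 _) (norm_nonneg _) hM
  -- Bounds both `ψR` and `(ψR)'' = ψ''R + 2ψ'R' + ψR''`, with `R' = iR²` of norm at most `M²`. It
  -- is independent of `a` because all the bounds on `R` are uniform on the axis.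
  set C₀ : ℝ := b * M + 2 * (b * (M * M)) + b * (M * M * M + M * (M * M)) with hC₀
  have dψ : ∀ a l, HasDerivAt (fun l => ψ (l - a)) (ψ' (l - a)) l := fun a l =>
    (hψ (l - a)).comp_sub_const l a
  have dψ' : ∀ a l, HasDerivAt (fun l => ψ' (l - a)) (ψ'' (l - a)) l := fun a l =>
    (hψ' (l - a)).comp_sub_const l a
  have cψ : Continuous ψ := continuous_iff_continuousAt.2 fun l => (hψ l).continuousAt
  have cψ' : Continuous ψ' := continuous_iff_continuousAt.2 fun l => (hψ' l).continuousAt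
  refine ⟨ψ, 4 * 3 * C₀ * Real.pi, hone, fun a => ⟨?_, integral_norm_synth_le (c := a)
    (f' := fun l => ψ (l - a) • R1 l + ψ' (l - a) • R l)
    (f'' := fun l => (ψ (l - a) • R2 l + ψ' (l - a) • R1 l)
      + (ψ' (l - a) • R1 l + ψ'' (l - a) • R l))
    (by norm_num) (fun l => (dψ a l).smul (dR l)) (fun l => ((dψ a l).smul (dR1 l)).add
      ((dψ' a l).smul (dR l))) ?_ ?_ ?_ ?_ ?_ ?_⟩⟩
  · refine integrable_of_forall_abs_sub (c := a) (r := 3)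
      ((cψ.comp (by fun_prop)).smul cR) fun l hl => ?_
    rw [(hzero _ hl).1, zero_smul]
  · have hs : Continuous fun l : ℝ => l - a := by fun_prop
    exact (((cψ.comp hs).smul cR2).add ((cψ'.comp hs).smul cR1)).add
      (((cψ'.comp hs).smul cR1).add ((cψ''.comp hs).smul cR))
  · intro l hl
    rw [(hzero _ hl).1, zero_smul]
  · intro l hl
    rw [(hzero _ hl).1, (hzero _ hl).2.1, zero_smul, zero_smul, zero_add]
  · intro l hl
    rw [(hzero _ hl).1, (hzero _ hl).2.1, (hzero _ hl).2.2]
    simp only [zero_smul, zero_add]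
  · intro l
    have h0 : ‖ψ (l - a) • R l‖ ≤ b * M := by
      rw [norm_smul, Real.norm_eq_abs]
      exact mul_le_mul (hb _).1 (hR.bound _) (norm_nonneg _) hb0
    refine h0.trans ?_
    rw [hC₀, add_assoc]
    exact le_add_of_nonneg_right (by positivity)
  · intro l
    have h0 : ‖ψ (l - a) • R2 l‖ ≤ b * (M * M * M + M * (M * M)) := by
      rw [norm_smul, Real.norm_eq_abs]
      exact mul_le_mul (hb _).1 (bR2 _) (norm_nonneg _) hb0
    have h1 : ‖ψ' (l - a) • R1 l‖ ≤ b * (M * M) := by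
      rw [norm_smul, Real.norm_eq_abs]
      exact mul_le_mul (hb _).2.1 (bR1 _) (norm_nonneg _) hb0
    have h2 : ‖ψ'' (l - a) • R l‖ ≤ b * M := by
      rw [norm_smul, Real.norm_eq_abs]
      exact mul_le_mul (hb _).2.2 (hR.bound _) (norm_nonneg _) hb0
    refine (norm_add_le _ _).trans ?_
    have e1 := norm_add_le (ψ (l - a) • R2 l) (ψ' (l - a) • R1 l)
    have e2 := norm_add_le (ψ' (l - a) • R1 l) (ψ'' (l - a) • R l)
    linarith

end KernelBound

/-! ### Mild solutions and the inversion of `-d/dt + A` on `F_as` -/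

section Mild

variable {X : Type*} [NormedAddCommGroup X] [NormedSpace ℂ X] {T : ℝ≥0 → X →L[ℂ] X}

/-- `x` is a mild solution of `A x - x' = y` on the whole line. -/
def IsMild (T : ℝ≥0 → X →L[ℂ] X) (x y : ℝ → X) : Prop :=
  ∀ s t : ℝ, s ≤ t → x t = T (t - s).toNNReal (x s) - ∫ τ in s..t, T (t - τ).toNNReal (y τ)

theorem isMild_zero : IsMild T (0 : ℝ →ᵇ X) (0 : ℝ →ᵇ X) := by
  intro s t _
  simp

variable [CompleteSpace X]

theorem IsC0Semigroup.intervalIntegrable (hT : IsC0Semigroup T) (y : ℝ →ᵇ X) (s t r : ℝ) :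
    IntervalIntegrable (fun τ => T (r - τ).toNNReal (y τ)) volume s t :=
  (hT.continuous_apply (by fun_prop) y.continuous).intervalIntegrable _ _

theorem IsMild.add (hT : IsC0Semigroup T) {x y x' y' : ℝ →ᵇ X} (h : IsMild T x y)
    (h' : IsMild T x' y') : IsMild T (x + x' : ℝ →ᵇ X) (y + y' : ℝ →ᵇ X) := by
  intro s t hst
  simp only [BoundedContinuousFunction.coe_add, Pi.add_apply, map_add]
  rw [intervalIntegral.integral_add (hT.intervalIntegrable y s t t)
    (hT.intervalIntegrable y' s t t), h s t hst, h' s t hst]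
  abel

theorem IsMild.sum (hT : IsC0Semigroup T) {ι : Type*} (S : Finset ι) {x y : ι → ℝ →ᵇ X}
    (h : ∀ i, IsMild T (x i) (y i)) :
    IsMild T (∑ i ∈ S, x i : ℝ →ᵇ X) (∑ i ∈ S, y i : ℝ →ᵇ X) := by
  classical
  induction S using Finset.induction_on with
  | empty => simpa using isMild_zero (T := T)
  | insert i S hi ih =>
    rw [Finset.sum_insert hi, Finset.sum_insert hi]
    exact (h i).add hT ih

/-- Mild solutions are closed under uniform limits. -/
theorem IsMild.of_tendsto (hT : IsC0Semigroup T) {ι : Type*} {l : Filter ι} [l.NeBot]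
    {x y : ι → ℝ →ᵇ X} {x₀ y₀ : ℝ →ᵇ X} (hx : Tendsto x l (𝓝 x₀)) (hy : Tendsto y l (𝓝 y₀))
    (h : ∀ i, IsMild T (x i) (y i)) : IsMild T x₀ y₀ := by
  intro s t hst
  have hpt : ∀ r, Tendsto (fun i => x i r) l (𝓝 (x₀ r)) := fun r =>
    ((BoundedContinuousFunction.evalCLM ℂ r).continuous.tendsto x₀).comp hx
  obtain ⟨C, hC0, hC⟩ := hT.exists_bound (t - s).toNNReal
  have hint : Tendsto (fun i => ∫ τ in s..t, T (t - τ).toNNReal (y i τ)) l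
      (𝓝 (∫ τ in s..t, T (t - τ).toNNReal (y₀ τ))) := by
    rw [tendsto_iff_norm_sub_tendsto_zero]
    have hb : ∀ i, ‖(∫ τ in s..t, T (t - τ).toNNReal (y i τ)) -
        ∫ τ in s..t, T (t - τ).toNNReal (y₀ τ)‖ ≤ C * ‖y i - y₀‖ * |t - s| := by
      intro i
      rw [← intervalIntegral.integral_sub (hT.intervalIntegrable _ s t t)
        (hT.intervalIntegrable _ s t t)]
      refine intervalIntegral.norm_integral_le_of_norm_le_const fun τ hτ => ?_
      rw [Set.uIoc_of_le hst] at hτ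
      rw [← map_sub]
      refine (T _).le_of_opNorm_le_of_le (hC _ (Real.toNNReal_le_toNNReal (by linarith [hτ.1]))) ?_
      exact (y i - y₀).norm_coe_le_norm τ
    refine squeeze_zero (fun _ => norm_nonneg _) hb ?_
    have := ((tendsto_iff_norm_sub_tendsto_zero.1 hy).const_mul C).mul_const |t - s|
    simpa using this
  refine tendsto_nhds_unique (hpt t) ?_
  refine Tendsto.congr (fun i => (h i s t hst).symm) (Tendsto.sub ?_ hint)
  exact ((T _).continuous.tendsto _).comp (hpt s)

/-- Integrals of mild solutions with respect to a parameter are mild solutions. -/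
theorem IsC0Semigroup.integral_mild (hT : IsC0Semigroup T) {s t : ℝ} (hst : s ≤ t)
    {ps pt : ℝ → X} {q : ℝ → ℝ → X} (hps : Integrable ps)
    (hq : Integrable (Function.uncurry q) ((volume.restrict (Set.Ioc s t)).prod volume))
    (h : ∀ u, pt u = T (t - s).toNNReal (ps u) - ∫ τ in s..t, T (t - τ).toNNReal (q τ u)) :
    ∫ u, pt u = T (t - s).toNNReal (∫ u, ps u) -
      ∫ τ in s..t, T (t - τ).toNNReal (∫ u, q τ u) := by
  obtain ⟨C, hC0, hC⟩ := hT.exists_bound (t - s).toNNReal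
  have key : Integrable (Function.uncurry fun τ u => T (t - τ).toNNReal (q τ u))
      ((volume.restrict (Set.Ioc s t)).prod volume) := by
    refine (hq.norm.const_mul C).mono' ?_ ?_
    · have hfst : Continuous fun p : ℝ × ℝ => (t - p.1).toNNReal := by fun_prop
      exact hT.continuous_uncurry.comp_aestronglyMeasurable
        (hfst.aestronglyMeasurable.prodMk hq.1)
    · have : ∀ᵐ p : ℝ × ℝ ∂(volume.restrict (Set.Ioc s t)).prod volume, p.1 ∈ Set.Ioc s t :=
        Measure.quasiMeasurePreserving_fst.ae (ae_restrict_mem measurableSet_Ioc)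
      filter_upwards [this] with p hp
      exact (T _).le_of_opNorm_le (hC _ (Real.toNNReal_le_toNNReal (by linarith [hp.1]))) _
  simp only [intervalIntegral.integral_of_le hst] at h ⊢
  calc ∫ u, pt u = ∫ u, (T (t - s).toNNReal (ps u) -
        ∫ τ in Set.Ioc s t, T (t - τ).toNNReal (q τ u)) := by simp only [h]
    _ = (∫ u, T (t - s).toNNReal (ps u)) -
        ∫ u, ∫ τ in Set.Ioc s t, T (t - τ).toNNReal (q τ u) :=
        integral_sub ((T _).integrable_comp hps) key.integral_prod_right
    _ = T (t - s).toNNReal (∫ u, ps u) -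
        ∫ τ in Set.Ioc s t, ∫ u, T (t - τ).toNNReal (q τ u) := by
        rw [(T _).integral_comp_comm hps, integral_integral_swap key]
    _ = _ := by
        congr 1
        refine integral_congr_ae ?_
        filter_upwards [hq.prod_right_ae] with τ hτ
        exact (T _).integral_comp_comm hτ

variable {R : ℝ → X →L[ℂ] X} {M : ℝ}

namespace IsResolventFamily

/-- A superposition of the exponential solutions of `mild_exp` over `l`, with weight `(2π)⁻¹
triangle(l - c) e^{-ilu}`. -/
theorem mild_synth (hR : IsResolventFamily T R M) (hT : IsC0Semigroup T) (c u : ℝ) {s t : ℝ}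
    (hst : s ≤ t) (v : X) :
    synth (fun l => ctri (l - c) • R l) (t - u) v
      = T (t - s).toNNReal (synth (fun l => ctri (l - c) • R l) (s - u) v)
        - ∫ τ in s..t, T (t - τ).toNNReal (phi c (τ - u) • v) := by
  set κ : ℂ := 1 / (2 * Real.pi)
  have hH : ∀ r : ℝ, synth (fun l => ctri (l - c) • R l) (r - u) v
      = ∫ l : ℝ, (κ * ctri (l - c) * Complex.exp (-(Complex.I * l * u))) •
          Complex.exp (Complex.I * l * r) • R l v := by
    intro r
    rw [hR.synth_ctri_smul_apply, synth, ← integral_smul]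
    refine integral_congr_ae (ae_of_all _ fun l => ?_)
    simp only [smul_smul]
    congr 1
    rw [mul_assoc _ (Complex.exp _), ← Complex.exp_add, show -(Complex.I * (l : ℂ) * u) +
      Complex.I * l * r = Complex.I * (l : ℂ) * ((r - u : ℝ) : ℂ) by push_cast; ring]
    ring
  have hphi : ∀ τ : ℝ, phi c (τ - u) • v
      = ∫ l : ℝ, (κ * ctri (l - c) * Complex.exp (-(Complex.I * l * u))) •
          Complex.exp (Complex.I * l * τ) • v := by
    intro τ
    rw [phi_eq_synth, synth, ← integral_smul, ← integral_smul_const]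
    refine integral_congr_ae (ae_of_all _ fun l => ?_)
    simp only [smul_smul, smul_eq_mul]
    congr 1
    rw [mul_assoc _ (Complex.exp _), ← Complex.exp_add, show -(Complex.I * (l : ℂ) * u) +
      Complex.I * l * τ = Complex.I * (l : ℂ) * ((τ - u : ℝ) : ℂ) by push_cast; ring]
    ring
  have hw : Integrable fun l : ℝ => κ * ctri (l - c) * Complex.exp (-(Complex.I * l * u)) :=
    ((integrable_ctri_sub c).const_mul κ).mul_bdd (c := 1)
      (Continuous.aestronglyMeasurable (by fun_prop))
      (ae_of_all _ fun l => (norm_exp_neg_I_mul l u).le)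
  have hexp : ∀ r : ℝ, Continuous fun l : ℝ => Complex.exp (Complex.I * l * r) := fun r => by
    fun_prop
  rw [hH, hH]
  simp only [hphi]
  refine hT.integral_mild hst ?_ ?_ fun l => ?_
  · refine hw.smul_bdd (f := fun l : ℝ => Complex.exp (Complex.I * l * s) • R l v) (M * ‖v‖)
      ((hexp s).smul (hR.continuous.clm_apply continuous_const)).aestronglyMeasurable
      (ae_of_all _ fun l => ?_)
    rw [norm_smul, norm_exp_I_mul, one_mul]
    exact (R l).le_of_opNorm_le (hR.bound l) v
  · have h1 : Integrable (fun p : ℝ × ℝ =>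
        κ * ctri (p.2 - c) * Complex.exp (-(Complex.I * p.2 * u)))
        ((volume.restrict (Set.Ioc s t)).prod volume) := hw.comp_snd _
    have h2 : Continuous fun p : ℝ × ℝ => Complex.exp (Complex.I * p.2 * p.1) • v := by
      have : Continuous fun p : ℝ × ℝ => Complex.exp (Complex.I * p.2 * p.1) := by fun_prop
      exact this.smul continuous_const
    exact h1.smul_bdd ‖v‖ h2.aestronglyMeasurable (ae_of_all _ fun p => by
      rw [norm_smul, norm_exp_I_mul, one_mul])
  · rw [hR.mild_exp hT l hst v, smul_sub, map_smul, ← intervalIntegral.integral_smul]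
    simp only [map_smul]

/-- Superposing the solutions of `mild_synth` over `u`, with `v = y u`, turns the kernels into
convolutions. -/
theorem isMild_convOp (hR : IsResolventFamily T R M) (hT : IsC0Semigroup T) (c : ℝ)
    (h : Integrable (synth fun l => ctri (l - c) • R l)) (y : ℝ →ᵇ X) :
    IsMild T (convOp _ h y) (phiC c y) := by
  intro s t hst
  have e1 : ∀ r, convOp _ h y r = ∫ u, synth (fun l => ctri (l - c) • R l) (r - u) (y u) := by
    intro r
    rw [convOp_apply, ← integral_sub_left_eq_self _ _ r]
    simp only [sub_sub_cancel]
  have i1 : Integrable fun u => synth (fun l => ctri (l - c) • R l) (s - u) (y u) := by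
    simpa using (integrable_kernel_apply h y s).comp_sub_left s
  have e2 : ∀ r, phiC c y r = ∫ u, phi c (r - u) • y u := by
    intro r
    rw [phiC_apply, phiConv, ← integral_sub_left_eq_self _ _ r]
    simp only [sub_sub_cancel]
  have i2 : ∀ r, Integrable fun u => phi c (r - u) • y u := by
    intro r
    simpa using (integrable_kernel_apply (integrable_phi_smul c) y r).comp_sub_left r
  rw [e1, e1]
  simp only [e2]
  refine hT.integral_mild hst i1 ?_ fun u => hR.mild_synth hT c u hst (y u)
  have hcont : Continuous (Function.uncurry fun τ u : ℝ => phi c (τ - u) • y u) :=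
    ((continuous_phi c).comp (continuous_fst.sub continuous_snd)).smul
      (y.continuous.comp continuous_snd)
  rw [integrable_prod_iff hcont.aestronglyMeasurable]
  refine ⟨ae_of_all _ i2, ?_⟩
  refine Integrable.of_bound (C := phiL1 * ‖y‖)
    hcont.aestronglyMeasurable.norm.integral_prod_right' (ae_of_all _ fun τ => ?_)
  rw [Real.norm_of_nonneg (integral_nonneg fun _ => norm_nonneg _), ← integral_norm_phi c,
    ← integral_mul_const, ← integral_sub_left_eq_self (fun u => ‖phi c u‖ * ‖y‖) _ τ]
  refine integral_mono (i2 τ).norm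
    (((integrable_phi c).norm.mul_const _).comp_sub_left τ) fun u => ?_
  simp only [Function.uncurry]
  rw [norm_smul]
  gcongr
  exact y.norm_coe_le_norm u

theorem existsUnique_isL (hR : IsResolventFamily T R M) (hT : IsC0Semigroup T) {y : ℝ →ᵇ X}
    (hy : MemAS y) : ∃! x : ℝ →ᵇ X, IsL T x y := by
  refine existsUnique_of_exists_of_unique ?_ ?_
  · obtain ⟨ψ, C, hψ, hker⟩ := hR.exists_kernel
    choose hf hK hKC using hker
    -- The solution for the `n`-th piece of `y`. The smooth cut-off gives the uniform `L¹` bound;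
    -- since it is one on the support of the triangle, the total symbol is `triangle(l - n) R l`.
    set x : ℤ → ℝ →ᵇ X := fun n => convOp _ (hK n) (phiC (n : ℝ) y)
    have hC0 : 0 ≤ C := (integral_nonneg fun _ => norm_nonneg _).trans (hKC 0)
    have hxn : ∀ n, ‖x n‖ ≤ C * ‖phiC (n : ℝ) y‖ := fun n =>
      (norm_convOp_le _ _).trans (mul_le_mul_of_nonneg_right (hKC n) (norm_nonneg _))
    have hsum : Summable x := (Summable.of_norm_bounded ((summable_norm_phiC hy).mul_left C) hxn)
    have hmild : ∀ n, IsMild T (x n) (phiC (n : ℝ) y) := by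
      intro n
      obtain ⟨h, e⟩ := phiC_convOp_synth (n : ℝ) (hf n) (hK n) y
      have hsym : (fun l => ctri (l - (n : ℝ)) • ψ (l - n) • R l)
          = fun l => ctri (l - (n : ℝ)) • R l := by
        ext l : 1
        rcases le_or_gt 1 |l - n| with hl | hl
        · rw [ctri_eq_zero hl, zero_smul, zero_smul]
        · rw [hψ _ hl.le, one_smul]
      have hx : x n = convOp _ h y := (convOp_phiC (hK n) n y).trans e
      rw [hx]
      simp only [hsym] at h ⊢
      exact hR.isMild_convOp hT n h y
    refine ⟨∑' n, x n, memAS_iff.2 ?_, hy, ?_⟩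
    · refine (asNorm_le_tsum hsum.hasSum).trans_lt ?_
      -- Convolution commutes with every `φ_k`, so `x n` keeps the band of `φ_n * y`: pieces with
      -- `|k - n| ≥ 2` vanish.
      have hbd : ∀ n, asNorm (x n) ≤ ((2 * 2 + 1 : ℕ) : ℝ≥0∞) * (5 * (ENNReal.ofReal phiL1 *
          (ENNReal.ofReal C * ‖phiC (n : ℝ) y‖ₑ))) := by
        intro n
        refine (asNorm_le_of_band n 2 fun k hk => ?_).trans ?_
        · change phiC (k : ℝ) (convOp _ (hK n) (phiC (n : ℝ) y)) = 0
          rw [← convOp_phiC, phiC_phiC_eq_zero (by exact_mod_cast hk), map_zero]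
        · gcongr
          have := ENNReal.ofReal_le_ofReal (hxn n)
          rwa [ENNReal.ofReal_mul hC0, ofReal_norm, ofReal_norm] at this
      refine (ENNReal.tsum_le_tsum hbd).trans_lt ?_
      simp only [ENNReal.tsum_mul_left]
      exact ENNReal.mul_lt_top (ENNReal.natCast_lt_top _) (ENNReal.mul_lt_top (by simp)
        (ENNReal.mul_lt_top (by simp) (ENNReal.mul_lt_top (by simp) (tsum_enorm_phiC_lt_top hy))))
    · exact IsMild.of_tendsto hT hsum.hasSum (hasSum_phiC hy) fun S => IsMild.sum hT S hmild
  · rintro x x' ⟨-, -, hx⟩ ⟨-, -, hx'⟩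
    rw [← sub_eq_zero]
    -- The inhomogeneous terms cancel, so the difference is a bounded orbit.
    refine hR.eq_zero_of_orbit hT fun s t hst => ?_
    rw [BoundedContinuousFunction.coe_sub, Pi.sub_apply, Pi.sub_apply, hx s t hst, hx' s t hst,
      map_sub]
    abel

end IsResolventFamily

end Mild

/-! ### Picard iteration in `F_as`, and uniqueness up to the boundary of the ball -/

section FixedPoint

variable {X : Type*} [NormedAddCommGroup X] [NormedSpace ℂ X] [CompleteSpace X]

/-- Completeness of `F_as` for its norm. -/
theorem exists_tendsto_of_asNorm_sub_le {f : ℕ → ℝ →ᵇ X} {ε : ℕ → ℝ≥0∞}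
    (hf : ∀ i j, i ≤ j → asNorm (f j - f i) ≤ ε i) (hε : Tendsto ε atTop (𝓝 0)) :
    ∃ p, Tendsto f atTop (𝓝 p) ∧ ∀ i, asNorm (p - f i) ≤ ε i := by
  have hc : CauchySeq f := by
    rw [EMetric.cauchySeq_iff_le_tendsto_0]
    refine ⟨fun i => ε i + ε i, fun n m N hn hm => ?_, by simpa using hε.add hε⟩
    refine (edist_triangle_right _ _ (f N)).trans (add_le_add ?_ ?_)
    · rw [edist_eq_enorm_sub]
      exact (enorm_le_asNorm _).trans (hf N n hn)
    · rw [edist_eq_enorm_sub]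
      exact (enorm_le_asNorm _).trans (hf N m hm)
  obtain ⟨p, hp⟩ := cauchySeq_tendsto_of_complete hc
  refine ⟨p, hp, fun i => asNorm_le_of_tendsto (hp.sub_const (f i)) ?_⟩
  filter_upwards [eventually_ge_atTop i] with j hj using hf i j hj

variable {T : ℝ≥0 → X →L[ℂ] X} {R : ℝ → X →L[ℂ] X} {M : ℝ}

namespace IsResolventFamily

theorem isL_LInv (hR : IsResolventFamily T R M) (hT : IsC0Semigroup T) {y : ℝ →ᵇ X}
    (hy : MemAS y) : IsL T (LInv T y) y := by
  have h : ∃ x, IsL T x y := (hR.existsUnique_isL hT hy).exists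
  rw [LInv, dif_pos h]
  exact Classical.choose_spec h

theorem LInv_eq (hR : IsResolventFamily T R M) (hT : IsC0Semigroup T) {x y : ℝ →ᵇ X}
    (h : IsL T x y) : LInv T y = x :=
  (hR.existsUnique_isL hT h.2.1).unique (hR.isL_LInv hT h.2.1) h

variable {n : ℕ} {F : (k : ℕ) → ContinuousMultilinearMap ℂ (fun _ : Fin k => X) X}

theorem isL_Phi (hR : IsResolventFamily T R M) (hT : IsC0Semigroup T) {x : ℝ →ᵇ X}
    (hx : MemAS x) : IsL T (Phi T n F x) (polyComp n F x) :=
  hR.isL_LInv hT (hx.polyComp n F)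

/-- `Φ` is closed with respect to uniform convergence. -/
theorem Phi_eq_of_tendsto (hR : IsResolventFamily T R M) (hT : IsC0Semigroup T)
    {u : ℕ → ℝ →ᵇ X} {x p : ℝ →ᵇ X} (hu : ∀ k, MemAS (u k)) (hx : MemAS x) (hp : MemAS p)
    (hux : Tendsto u atTop (𝓝 x)) (hup : Tendsto (fun k => Phi T n F (u k)) atTop (𝓝 p)) :
    Phi T n F x = p :=
  hR.LInv_eq hT ⟨hp, hx.polyComp n F, IsMild.of_tendsto hT hup
    (((continuous_polyComp n F).tendsto x).comp hux) fun k => (hR.isL_Phi hT (hu k)).2.2⟩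

/-- Picard iteration from `z`: the first step has length `‖Φ(z)‖`, so all iterates and the limit
stay within `‖Φ(z)‖ / (1 - K) < β` of `z`. -/
theorem exists_isMildSolution (hR : IsResolventFamily T R M) (hT : IsC0Semigroup T) {β : ℝ}
    {K : ℝ≥0} {y : ℝ →ᵇ X} (hK : K < 1) (hy : MemAS y)
    (hLip : AsLipschitzOn K (Phi T n F) (asBall (LInv T y) β))
    (hΦ : asNorm (Phi T n F (LInv T y)) * (1 - (K : ℝ≥0∞))⁻¹ < ENNReal.ofReal β) :
    ∃ x, IsMildSolution T n F y x ∧ asNorm (x - LInv T y) < ENNReal.ofReal β := by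
  set z := LInv T y
  set Φ := Phi T n F
  set d := asNorm (Φ z)
  have hz : MemAS z := (hR.isL_LInv hT hy).1
  have hK' : (K : ℝ≥0∞) < 1 := by exact_mod_cast hK
  let x : ℕ → ℝ →ᵇ X := fun k => (fun v => z + Φ v)^[k] z
  have hx0 : x 0 = z := rfl
  have hx1 : ∀ k, x (k + 1) = z + Φ (x k) := fun k => Function.iterate_succ_apply' _ _ _
  have hgeom : ∀ (i m : ℕ), (∀ l < m, asNorm (x (i + l + 1) - x (i + l)) ≤ K ^ (i + l) * d) →
      asNorm (x (i + m) - x i) ≤ (K : ℝ≥0∞) ^ i * (d * (1 - (K : ℝ≥0∞))⁻¹) := by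
    intro i m h
    have h1 : asNorm (x (i + m) - x i) ≤ ∑ l ∈ Finset.range m, (K : ℝ≥0∞) ^ (i + l) * d := by
      have : x (i + m) - x i = ∑ l ∈ Finset.range m, (x (i + l + 1) - x (i + l)) := by
        have := Finset.sum_range_sub (fun l => x (i + l)) m
        rw [add_zero] at this
        exact this.symm
      rw [this]
      exact (asNorm_sum_le _ _).trans
        (Finset.sum_le_sum fun l hl => h l (Finset.mem_range.1 hl))
    refine h1.trans ?_
    simp only [pow_add, mul_assoc]
    rw [← Finset.mul_sum, ← Finset.sum_mul, mul_comm d, ← ENNReal.tsum_geometric]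
    gcongr
    exact ENNReal.sum_le_tsum _
  have hstep : ∀ k, (∀ l ≤ k, MemAS (x l)) ∧
      ∀ l ≤ k, asNorm (x (l + 1) - x l) ≤ (K : ℝ≥0∞) ^ l * d := by
    intro k
    induction k with
    | zero =>
      refine ⟨fun l hl => ?_, fun l hl => ?_⟩
      · rw [Nat.le_zero.1 hl]
        exact hz
      · rw [Nat.le_zero.1 hl, hx1, hx0, add_sub_cancel_left, pow_zero, one_mul]
    | succ k ih =>
      have hm : MemAS (x (k + 1)) := by
        rw [hx1]
        exact hz.add (hR.isL_Phi hT (ih.1 k le_rfl)).1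
      have hball : ∀ l ≤ k + 1, x l ∈ asBall z β := by
        intro l hl
        refine ⟨?_, ?_⟩
        · rcases Nat.le_succ_iff.1 hl with h | h
          · exact ih.1 l h
          · rw [h]; exact hm
        · have := hgeom 0 l fun l' hl' => by
            rw [zero_add]
            exact ih.2 l' (by omega)
          rw [zero_add, pow_zero, one_mul, hx0] at this
          exact this.trans_lt hΦ
      refine ⟨fun l hl => (hball l hl).1, fun l hl => ?_⟩
      rcases Nat.le_succ_iff.1 hl with h | h
      · exact ih.2 l h
      · rw [h, hx1 (k + 1)]
        nth_rw 2 [hx1 k]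
        rw [add_sub_add_left_eq_sub]
        refine (hLip _ (hball _ le_rfl) _ (hball k (by omega))).trans ?_
        rw [pow_succ', mul_assoc]
        gcongr
        exact ih.2 k le_rfl
  have hmem : ∀ k, MemAS (x k) := fun k => (hstep k).1 k le_rfl
  have hε : Tendsto (fun i : ℕ => (K : ℝ≥0∞) ^ i * (d * (1 - (K : ℝ≥0∞))⁻¹)) atTop (𝓝 0) := by
    have := ENNReal.Tendsto.mul_const (b := d * (1 - (K : ℝ≥0∞))⁻¹)
      (ENNReal.tendsto_pow_atTop_nhds_zero_of_lt_one hK') (Or.inr (hΦ.trans ENNReal.ofReal_lt_top).ne)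
    simpa using this
  obtain ⟨p, hp, hpi⟩ := exists_tendsto_of_asNorm_sub_le (f := x) (fun i j hij => by
    obtain ⟨m, rfl⟩ := Nat.exists_eq_add_of_le hij
    exact hgeom i m fun l _ => (hstep (i + l)).2 _ le_rfl) hε
  have hpz : asNorm (p - z) < ENNReal.ofReal β := by
    have := hpi 0
    rw [hx0, pow_zero, one_mul] at this
    exact this.trans_lt hΦ
  have hpz' : MemAS (p - z) := memAS_iff.2 (hpz.trans ENNReal.ofReal_lt_top)
  have hpm : MemAS p := by simpa using hpz'.add hz
  refine ⟨p, ⟨hpm, ?_⟩, hpz⟩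
  have : Φ p = p - z := by
    refine hR.Phi_eq_of_tendsto hT hmem hpm hpz' hp ?_
    refine (((tendsto_add_atTop_iff_nat 1).2 hp).sub_const z).congr fun k => ?_
    rw [hx1, add_sub_cancel_left]
  change p = z + Φ p
  rw [this, add_sub_cancel]

/-- A mild solution in the closed ball lies in the open ball. -/
theorem asNorm_sub_lt_of_isMildSolution (hR : IsResolventFamily T R M) (hT : IsC0Semigroup T)
    {β : ℝ} {K : ℝ≥0} {x y : ℝ →ᵇ X} (hβ : 0 < β) (hy : MemAS y)
    (hLip : AsLipschitzOn K (Phi T n F) (asBall (LInv T y) β))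
    (hΦ : asNorm (Phi T n F (LInv T y)) + K * ENNReal.ofReal β < ENNReal.ofReal β)
    (hx : IsMildSolution T n F y x) (hxβ : asNorm (x - LInv T y) ≤ ENNReal.ofReal β) :
    asNorm (x - LInv T y) < ENNReal.ofReal β := by
  obtain ⟨hxm, hxe⟩ := hx
  set z := LInv T y
  set Φ := Phi T n F
  have hz : MemAS z := (hR.isL_LInv hT hy).1
  -- Points `z + s k • (x - z)` of the segment from `z` to `x`: they start at `z`, since `s 0 = 0`,
  -- stay in the open ball, and tend to `x`.
  set s : ℕ → ℝ := fun k => 1 - 1 / ((k : ℝ) + 1) with hs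
  have hs0 : ∀ k, 0 ≤ s k := fun k => by
    have : 1 / ((k : ℝ) + 1) ≤ 1 := by
      rw [div_le_one (by positivity)]
      linarith [(Nat.cast_nonneg k : (0 : ℝ) ≤ k)]
    simp only [hs]
    linarith
  have hs1 : ∀ k, s k < 1 := fun k => by
    have : 0 < 1 / ((k : ℝ) + 1) := by positivity
    simp only [hs]
    linarith
  have hsm : Monotone s := fun i j hij => by
    have : 1 / ((j : ℝ) + 1) ≤ 1 / ((i : ℝ) + 1) := by gcongr
    simp only [hs]
    linarith
  have hst : Tendsto s atTop (𝓝 1) := by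
    simpa [hs] using tendsto_one_div_add_atTop_nhds_zero_nat (𝕜 := ℝ).const_sub 1
  let u : ℕ → ℝ →ᵇ X := fun k => z + (s k : ℂ) • (x - z)
  have hu0 : u 0 = z := by simp [u, s]
  have hball : ∀ k, u k ∈ asBall z β := by
    intro k
    refine ⟨hz.add ((hxm.sub hz).smul _), ?_⟩
    rw [add_sub_cancel_left, asNorm_smul, ← ofReal_norm, Complex.norm_real,
      Real.norm_of_nonneg (hs0 k)]
    refine (mul_le_mul_right hxβ _).trans_lt ?_
    rw [← ENNReal.ofReal_mul (hs0 k), ENNReal.ofReal_lt_ofReal_iff hβ]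
    exact mul_lt_of_lt_one_left hβ (hs1 k)
  have hux : Tendsto u atTop (𝓝 x) := by
    have h1 : Tendsto (fun k => (s k : ℂ)) atTop (𝓝 ((1 : ℝ) : ℂ)) :=
      (Complex.continuous_ofReal.tendsto 1).comp hst
    have := (h1.smul_const (x - z)).const_add z
    rw [Complex.ofReal_one, one_smul, add_sub_cancel] at this
    exact this
  have hdiff : ∀ i j, i ≤ j → asNorm (Φ (u j) - Φ (u i)) ≤
      K * (ENNReal.ofReal (1 - s i) * asNorm (x - z)) := by
    intro i j hij
    refine (hLip _ (hball j) _ (hball i)).trans ?_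
    rw [add_sub_add_left_eq_sub, ← sub_smul, asNorm_smul, ← ofReal_norm, ← Complex.ofReal_sub,
      Complex.norm_real, Real.norm_of_nonneg (sub_nonneg.2 (hsm hij))]
    gcongr
    exact (hs1 j).le
  have hε : Tendsto (fun i => K * (ENNReal.ofReal (1 - s i) * asNorm (x - z))) atTop (𝓝 0) := by
    have h1 : Tendsto (fun i => ENNReal.ofReal (1 - s i)) atTop (𝓝 0) := by
      have := (ENNReal.continuous_ofReal.tendsto _).comp (hst.const_sub 1)
      rw [sub_self, ENNReal.ofReal_zero] at this
      exact this
    have h2 := ENNReal.Tendsto.mul_const h1 (b := asNorm (x - z))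
      (Or.inr (hxm.sub hz).asNorm_lt_top.ne)
    have h3 := ENNReal.Tendsto.const_mul h2 (a := (K : ℝ≥0∞)) (Or.inr ENNReal.coe_ne_top)
    simpa using h3
  obtain ⟨p, hp, hpi⟩ := exists_tendsto_of_asNorm_sub_le hdiff hε
  have hp0 := hpi 0
  have hs00 : ENNReal.ofReal (1 - s 0) = 1 := by simp [s]
  rw [hu0, hs00, one_mul] at hp0
  have hΦz : MemAS (Φ z) := (hR.isL_Phi hT hz).1
  have hpm : MemAS p := by
    have : MemAS (p - Φ z) := memAS_iff.2 (hp0.trans_lt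
      (ENNReal.mul_lt_top ENNReal.coe_lt_top (hxm.sub hz).asNorm_lt_top))
    simpa using this.add hΦz
  -- Closedness of `Φ` replaces the Lipschitz estimate, which is not available at `x` if `x` lies on
  -- the sphere; the estimate `‖Φ(x) - Φ(z)‖ ≤ K‖x - z‖` is inherited from `hp0`.
  have hpx : Φ x = p := hR.Phi_eq_of_tendsto hT (fun k => (hball k).1) hxm hpm hux hp
  have hxz : x - z = (p - Φ z) + Φ z := by
    rw [sub_add_cancel, ← hpx, sub_eq_iff_eq_add']
    exact hxe
  calc asNorm (x - z) ≤ asNorm (p - Φ z) + asNorm (Φ z) := by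
        nth_rw 1 [hxz]
        exact asNorm_add_le _ _
    _ ≤ K * ENNReal.ofReal β + asNorm (Φ z) := by
        gcongr
        exact hp0.trans (by gcongr)
    _ < ENNReal.ofReal β := by rwa [add_comm]

/-- Any solution in the closed ball already lies in the open one, so both solutions are subject to
the contraction, and `Φ(x') - Φ(x) = x' - x` forces equality. -/
theorem existsUnique_isMildSolution (hR : IsResolventFamily T R M) (hT : IsC0Semigroup T)
    {β : ℝ} {K : ℝ≥0} {y : ℝ →ᵇ X} (hβ : 0 < β) (hK : K < 1) (hy : MemAS y)
    (hLip : AsLipschitzOn K (Phi T n F) (asBall (LInv T y) β))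
    (hΦ : asNorm (Phi T n F (LInv T y)) < ENNReal.ofReal (β * (1 - K))) :
    ∃! x : ℝ →ᵇ X, IsMildSolution T n F y x ∧ asNorm (x - LInv T y) ≤ ENNReal.ofReal β := by
  have hK' : (K : ℝ≥0∞) < 1 := by exact_mod_cast hK
  have hK1 : (K : ℝ) < 1 := by exact_mod_cast hK
  have hsub : ENNReal.ofReal (1 - K) = 1 - (K : ℝ≥0∞) := by
    rw [ENNReal.ofReal_sub _ K.coe_nonneg, ENNReal.ofReal_one, ENNReal.ofReal_coe_nnreal]
  have h1 : asNorm (Phi T n F (LInv T y)) * (1 - (K : ℝ≥0∞))⁻¹ < ENNReal.ofReal β := by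
    rw [← div_eq_mul_inv]
    refine ENNReal.div_lt_of_lt_mul ?_
    rwa [← hsub, ← ENNReal.ofReal_mul hβ.le]
  have h2 : asNorm (Phi T n F (LInv T y)) + K * ENNReal.ofReal β < ENNReal.ofReal β := by
    have e : ENNReal.ofReal β
        = ENNReal.ofReal (β * (1 - K)) + (K : ℝ≥0∞) * ENNReal.ofReal β := by
      rw [← ENNReal.ofReal_coe_nnreal, ← ENNReal.ofReal_mul K.coe_nonneg, ← ENNReal.ofReal_add
        (mul_nonneg hβ.le (by linarith)) (mul_nonneg K.coe_nonneg hβ.le)]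
      congr 1
      ring
    conv_rhs => rw [e]
    exact ENNReal.add_lt_add_right (ENNReal.mul_ne_top ENNReal.coe_ne_top ENNReal.ofReal_ne_top) hΦ
  obtain ⟨x, hx, hxβ⟩ := hR.exists_isMildSolution hT hK hy hLip h1
  refine ⟨x, ⟨hx, hxβ.le⟩, fun x' ⟨hx', hxβ'⟩ => ?_⟩
  have hlt := hR.asNorm_sub_lt_of_isMildSolution hT hβ hy hLip h2 hx' hxβ'
  have hle := hLip x' ⟨hx'.1, hlt⟩ x ⟨hx.1, hxβ⟩
  have e : Phi T n F x' - Phi T n F x = x' - x := by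
    nth_rw 2 [hx'.2, hx.2]
    rw [add_sub_add_left_eq_sub]
  rw [e] at hle
  refine eq_of_asNorm_sub_eq_zero ?_
  by_contra h0
  refine absurd hle (not_le.2 ?_)
  calc (K : ℝ≥0∞) * asNorm (x' - x) < 1 * asNorm (x' - x) :=
        ENNReal.mul_lt_mul_left h0 (hx'.1.sub hx.1).asNorm_lt_top.ne hK'
    _ = _ := one_mul _

end IsResolventFamily

end FixedPoint

end ParabolicAS

theorem theorem5p1 {X : Type*} [NormedAddCommGroup X] [NormedSpace ℂ X] [CompleteSpace X]
    (T : ℝ≥0 → X →L[ℂ] X) (hT : ParabolicAS.IsC0Semigroup T)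
    (hspec : ParabolicAS.opSpectrum (ParabolicAS.generator T) ∩ ParabolicAS.imagAxis = ∅)
    (hres : ParabolicAS.ResolventBddOnImagAxis (ParabolicAS.generator T))
    (n : ℕ) (F : (k : ℕ) → ContinuousMultilinearMap ℂ (fun _ : Fin k => X) X) :
    -- `L⁻¹` is well defined on `F_as`, and `F` maps `F_as` to itself
    (∀ y : ℝ →ᵇ X, ParabolicAS.MemAS y → ∃! x : ℝ →ᵇ X, ParabolicAS.IsL T x y) ∧
    (∀ x : ℝ →ᵇ X, ParabolicAS.MemAS x → ParabolicAS.MemAS (ParabolicAS.polyComp n F x)) ∧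
    -- existence, uniqueness and localization of the mild solution
    ∀ (β : ℝ) (K : ℝ≥0) (y : ℝ →ᵇ X), 0 < β → K < 1 → ParabolicAS.MemAS y →
      ParabolicAS.AsLipschitzOn K (ParabolicAS.Phi T n F)
        (ParabolicAS.asBall (ParabolicAS.LInv T y) β) →
      ParabolicAS.asNorm (ParabolicAS.Phi T n F (ParabolicAS.LInv T y))
        < ENNReal.ofReal (β * (1 - K)) →
      ∃! x : ℝ →ᵇ X, ParabolicAS.IsMildSolution T n F y x ∧
        ParabolicAS.asNorm (x - ParabolicAS.LInv T y) ≤ ENNReal.ofReal β := by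
  obtain ⟨R, M, hR⟩ := ParabolicAS.exists_isResolventFamily hspec hres
  exact ⟨fun y hy => hR.existsUnique_isL hT hy, fun x hx => hx.polyComp n F,
    fun β K y hβ hK hy hLip hΦ => hR.existsUnique_isMildSolution hT hβ hK hy hLip hΦ⟩
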